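/- Let $G=N\rtimes H$ be a finite group with $N$ abelian; $H$ acts on $\mathrm{Irr}(N)$ (the linear characters of $N$) by $\psi^h(n)=\psi(hnh^{-1})$, and $I_H(\psi)$ is the stabilizer of $\psi$. A supercharacter theory of a finite group is a pair $(\mathcal K,\mathcal X)$ with $\mathcal K$ a partition of the group into unions of conjugacy classes (superclasses) and $\mathcal X$ a set of characters (supercharacters) such that $|\mathcal X|=|\mathcal K|$, every $\chi\in\mathcal X$ is constant on the blocks of $\mathcal K$, and each irreducible character is a constituent of exactly one $\chi\in\mathcal X$. A superclass function is a function constant on the superclasses. One theory is finer than or equal to another if each superclass of the first lies in a superclass of the second. Two theories coincide if they have the same superclasses; equivalently, if they have the same supercharacters up to positive scalar multiples. Let $\mathcal L$ be a sublattice of the subgroup lattice of $H$ that contains $H$ and $\{1\}$ and is closed under conjugation by $H$, each $K\in\mathcal L$ being equipped with a supercharacter theory such that, for $K_1\subseteq K_2$ in $\mathcal L$, induction and restriction between $K_1$ and $K_2$ send superclass functions to superclass functions, and such that $\chi^h$ is a supercharacter of $K^h=h^{-1}Kh$ whenever $\chi$ is a supercharacter of $K\in\mathcal L$ and $h\in H$.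 For each $\psi\in\mathrm{Irr}(N)$ let $H_\psi\in\mathcal L$ be a normal subgroup of $I_H(\psi)$, such that $H_{\psi^h}=(H_\psi)^h$ for all $h\in H$, $H_{1_N}=H$, and $H_\psi\cap H_\varphi\subseteq H_{\psi\varphi}$ for all $\psi,\varphi\in\mathrm{Irr}(N)$. For $K\subseteq I_H(\psi)$ and a character $\chi$ of $K$, let $\psi\rtimes\chi=\mathrm{Ind}_{NK}^G(\lambda)$, where $\lambda(nk)=\psi(n)\chi(k)$ for $n\in N$, $k\in K$. Let $S$ be a set of representatives of the $G$-orbits on $\mathrm{Irr}(N)$, and put $$\mathrm{SCh}(\mathcal L)=\{\psi\rtimes\mathrm{Ind}_{H_\psi}^{I_H(\psi)}(\chi)\mid \psi\in S,\ \chi\text{ a supercharacter of }H_\psi\}.$$ Let $\mathrm{SCT}(N)=(\mathcal K_N,\mathcal X_N)$ be the supercharacter theory of $N$ whose superclasses are the $G$-orbits on $N$ and whose supercharacters are the sums over the $G$-orbits on $\mathrm{Irr}(N)$, and let $\mathrm{SCT}(H)=(\mathcal K_H,\mathcal X_H)$ be the theory of $H\in\mathcal L$. The pair $\mathrm{SCT}(N)*\mathrm{SCT}(H)$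 has superclasses $\mathcal K_N\cup\{LN\mid L\in\mathcal K_H,\ L\ne\{1\}\}$ and supercharacters $\{\mathrm{Ind}_N^G\chi\mid\chi\in\mathcal X_N,\ \chi\neq 1_N\}\cup\{\mathrm{Inf}_H^G\chi\mid\chi\in\mathcal X_H\}$. **Lemma.** $\mathrm{SCh}(\mathcal L)$ is the set of supercharacters of a unique supercharacter theory of $G$, and $\mathrm{SCT}(N)*\mathrm{SCT}(H)$ is a supercharacter theory of $G$. The former is finer than or equal to the latter. The two coincide if and only if $H_\psi=\{1\}$ for every nontrivial $\psi\in\mathrm{Irr}(N)$. -/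

import Mathlib

open scoped Pointwise

noncomputable section

/-! ### Characters, induction and supercharacter theories of finite groups -/

/-- `f` is a (complex, nonzero, finite-dimensional) character of `G`. -/
def IsCharacter {G : Type*} [Group G] (f : G → ℂ) : Prop :=
  ∃ (n : ℕ) (ρ : Representation ℂ G (Fin n → ℂ)), n ≠ 0 ∧ f = ρ.character

/-- `f` is an irreducible complex character of `G`. -/
def IsIrrCharacter {G : Type*} [Group G] (f : G → ℂ) : Prop :=
  ∃ (n : ℕ) (ρ : Representation ℂ G (Fin n → ℂ)), ρ.IsIrreducible ∧ f = ρ.character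

/-- The usual inner product of complex functions on a finite group. -/
def charInner {G : Type*} [Group G] (f g : G → ℂ) : ℂ :=
  (Nat.card G : ℂ)⁻¹ * ∑ᶠ x : G, f x * star (g x)

/-- The irreducible character `θ` occurs with nonzero multiplicity in `χ`. -/
def IsConstituent {G : Type*} [Group G] (θ χ : G → ℂ) : Prop :=
  charInner χ θ ≠ 0

/-- Induction of functions along an injective homomorphism `i : A → B` of finite groups:
`Ind χ (b) = |A|⁻¹ ∑_{x ∈ B, x b x⁻¹ ∈ A} χ (x b x⁻¹)`, with `A` identified with its image. -/
def indFun {A B : Type*} [Group A] [Group B] (i : A →* B) (χ : A → ℂ) : B → ℂ :=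
  fun b => (Nat.card A : ℂ)⁻¹ *
    ∑ᶠ (x : B) (a : A) (_ : i a = x * b * x⁻¹), χ a

/-- `f` is constant on each block of `𝒦`. -/
def IsConstantOnBlocks {G : Type*} (𝒦 : Set (Set G)) (f : G → ℂ) : Prop :=
  ∀ K ∈ 𝒦, ∀ x ∈ K, ∀ y ∈ K, f x = f y

/-- A supercharacter theory of a finite group. -/
structure SupercharacterTheory (G : Type*) [Group G] where
  /-- the superclasses -/
  superclasses : Set (Set G)
  /-- the supercharacters -/
  supercharacters : Set (G → ℂ)
  isPartition : Setoid.IsPartition superclasses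
  conj_mem : ∀ K ∈ superclasses, ∀ x ∈ K, ∀ g : G, g * x * g⁻¹ ∈ K
  isCharacter : ∀ χ ∈ supercharacters, IsCharacter χ
  card_eq : supercharacters.ncard = superclasses.ncard
  constant : ∀ χ ∈ supercharacters, IsConstantOnBlocks superclasses χ
  existsUnique_constituent : ∀ θ : G → ℂ, IsIrrCharacter θ →
    ∃! χ, χ ∈ supercharacters ∧ IsConstituent θ χ

/-- Superclass functions: functions constant on the superclasses. -/
def SupercharacterTheory.IsSuperclassFunction {G : Type*} [Group G]
    (T : SupercharacterTheory G) (f : G → ℂ) : Prop :=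
  IsConstantOnBlocks T.superclasses f

/-- `T` is finer than or equal to `T'`: every superclass of `T` lies in a superclass of `T'`. -/
def SupercharacterTheory.IsFinerThan {G : Type*} [Group G]
    (T T' : SupercharacterTheory G) : Prop :=
  ∀ K ∈ T.superclasses, ∃ K' ∈ T'.superclasses, K ⊆ K'

/-- The two sets of functions agree up to positive scalar multiples. (Supercharacters are only
determined by the superclasses up to such multiples.) -/
def SameUpToScaling {G : Type*} (𝒳 𝒴 : Set (G → ℂ)) : Prop :=
  (∀ χ ∈ 𝒳, ∃ c : ℝ, 0 < c ∧ (c : ℂ) • χ ∈ 𝒴) ∧ (∀ χ ∈ 𝒴, ∃ c : ℝ, 0 < c ∧ (c : ℂ) • χ ∈ 𝒳)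

/-! ### The `*`-product

It is written for a short exact sequence `1 → N → G → Q → 1` given by `i` and `π`, so that `Q` plays
the role of `G ⧸ N` and inflation is composition with `π`. -/

/-- The superclasses of the `*`-product: the superclasses `K` of `N`, together with the preimages
in `G` of the superclasses `L ≠ {1}` of `Q`. -/
def starSuperclasses {N G Q : Type*} [Group N] [Group G] [Group Q] (i : N →* G) (π : G →* Q)
    (𝒦 : Set (Set N)) (𝓛 : Set (Set Q)) : Set (Set G) :=
  {M | ∃ K ∈ 𝒦, M = i '' K} ∪ {M | ∃ L ∈ 𝓛, L ≠ {1} ∧ M = π ⁻¹' L}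

/-- The supercharacters of the `*`-product: the characters induced from the supercharacters
`χ ≠ 1_N` of `N`, together with the inflations of the supercharacters of `Q`. -/
def starSupercharacters {N G Q : Type*} [Group N] [Group G] [Group Q] (i : N →* G) (π : G →* Q)
    (𝒳 : Set (N → ℂ)) (𝒴 : Set (Q → ℂ)) : Set (G → ℂ) :=
  {ζ | ∃ χ ∈ 𝒳, χ ≠ (fun _ => 1) ∧ ζ = indFun i χ} ∪ {ζ | ∃ χ ∈ 𝒴, ζ = fun g => χ (π g)}

/-! ### Lattices of subgroups with compatible supercharacter theories -/

/-- For `χ : K → ℂ`, the function `x ↦ χ (h⁻¹ x h)` on `h K h⁻¹`. -/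
def conjFun {H : Type*} [Group H] (h : H) (K : Subgroup H) (χ : K → ℂ) :
    (MulAut.conj h • K : Subgroup H) → ℂ :=
  fun x => χ ⟨h⁻¹ * x * h, by
    have hx := Subgroup.mem_pointwise_smul_iff_inv_smul_mem.mp x.2
    simpa [← map_inv, MulAut.smul_def] using hx⟩

/-- A lattice of subgroups of `H`, containing `H` and `1` and closed under conjugation, each member
of which carries a supercharacter theory, compatibly with induction, restriction, conjugation. -/
structure CompatibleLattice (H : Type*) [Group H] where
  /-- the lattice -/
  lattice : Sublattice (Subgroup H)
  top_mem : (⊤ : Subgroup H) ∈ lattice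
  bot_mem : (⊥ : Subgroup H) ∈ lattice
  conj_mem : ∀ K ∈ lattice, ∀ h : H, (MulAut.conj h • K : Subgroup H) ∈ lattice
  /-- the supercharacter theories of the members of the lattice -/
  theory : ∀ K ∈ lattice, SupercharacterTheory K
  ind_mem : ∀ (K₁ K₂ : Subgroup H) (h₁ : K₁ ∈ lattice) (h₂ : K₂ ∈ lattice) (hle : K₁ ≤ K₂)
    (f : K₁ → ℂ), (theory K₁ h₁).IsSuperclassFunction f →
      (theory K₂ h₂).IsSuperclassFunction (indFun (Subgroup.inclusion hle) f)
  res_mem : ∀ (K₁ K₂ : Subgroup H) (h₁ : K₁ ∈ lattice) (h₂ : K₂ ∈ lattice) (hle : K₁ ≤ K₂)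
    (f : K₂ → ℂ), (theory K₂ h₂).IsSuperclassFunction f →
      (theory K₁ h₁).IsSuperclassFunction (fun x => f (Subgroup.inclusion hle x))
  conjFun_mem : ∀ (K : Subgroup H) (hK : K ∈ lattice) (h : H),
    ∀ χ ∈ (theory K hK).supercharacters,
      conjFun h K χ ∈ (theory (MulAut.conj h • K) (conj_mem K hK h)).supercharacters

/-! ### The method of little groups for `N ⋊[φ] H`, `N` abelian

The irreducible characters of the finite abelian group `N` are its linear characters
`ψ : N →* ℂˣ`. As `N` is abelian, the conjugation action of `N ⋊[φ] H` on `N` and on the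
characters of `N` factors through `H`, which acts by `φ`. -/

section LittleGroups

variable {N H : Type*} [CommGroup N] [Group H]

/-- `ψ^h`, that is, `n ↦ ψ (h n h⁻¹)`. -/
def conjLin (φ : H →* MulAut N) (h : H) (ψ : N →* ℂˣ) : N →* ℂˣ :=
  ψ.comp (φ h).toMonoidHom

/-- The inertial subgroup `I_H(ψ)`. -/
def inertia (φ : H →* MulAut N) (ψ : N →* ℂˣ) : Subgroup H where
  carrier := {h | conjLin φ h ψ = ψ}
  one_mem' := by
    ext n
    simp [conjLin]
  mul_mem' := by
    intro a b ha hb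
    have ha' : ∀ n, ψ (φ a n) = ψ n := fun n => DFunLike.congr_fun ha n
    have hb' : ∀ n, ψ (φ b n) = ψ n := fun n => DFunLike.congr_fun hb n
    ext n
    simp [conjLin, ha', hb']
  inv_mem' := by
    intro a ha
    have ha' : ∀ n, ψ (φ a n) = ψ n := fun n => DFunLike.congr_fun ha n
    ext n
    have h1 := ha' ((φ a)⁻¹ n)
    simp at h1
    simp [conjLin, h1]

/-- Choices of subgroups `H_ψ` in the lattice, one for each irreducible character `ψ` of `N`. -/
structure LittleGroupChoice (φ : H →* MulAut N) (𝓛 : CompatibleLattice H) where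
  /-- the subgroup `H_ψ` -/
  grp : (N →* ℂˣ) → Subgroup H
  mem : ∀ ψ, grp ψ ∈ 𝓛.lattice
  le_inertia : ∀ ψ, grp ψ ≤ inertia φ ψ
  normal : ∀ ψ, ((grp ψ).subgroupOf (inertia φ ψ)).Normal
  conj : ∀ ψ (h : H), grp (conjLin φ h ψ) = MulAut.conj h⁻¹ • grp ψ
  one : grp 1 = ⊤
  inf_le : ∀ ψ ψ', grp ψ ⊓ grp ψ' ≤ grp (ψ * ψ')

/-- `S` is a set of orbit representatives for the conjugation action on `Irr(N)`. -/
def IsOrbitReps (φ : H →* MulAut N) (S : Set (N →* ℂˣ)) : Prop :=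
  ∀ ψ : N →* ℂˣ, ∃! s, s ∈ S ∧ ∃ h : H, s = conjLin φ h ψ

/-- For `K ≤ I_H(ψ)` and `χ : K → ℂ`, the function `ψ ⋊ χ` on `N ⋊[φ] H`: it is induced from the
function `n h ↦ ψ n * χ h` on the subgroup `N K`. -/
def psiRtimes (φ : H →* MulAut N) (ψ : N →* ℂˣ) (K : Subgroup H) (χ : K → ℂ) :
    N ⋊[φ] H → ℂ :=
  indFun (K.comap (SemidirectProduct.rightHom : N ⋊[φ] H →* H)).subtype
    (fun g => (ψ g.1.left : ℂ) * χ ⟨g.1.right, g.2⟩)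

/-- `S_ψ`: the functions on `I_H(ψ)` induced from the supercharacters of `H_ψ`. -/
def inducedSupercharacters {φ : H →* MulAut N} {𝓛 : CompatibleLattice H}
    (c : LittleGroupChoice φ 𝓛) (ψ : N →* ℂˣ) : Set (inertia φ ψ → ℂ) :=
  {ξ | ∃ χ ∈ (𝓛.theory (c.grp ψ) (c.mem ψ)).supercharacters,
    ξ = indFun (Subgroup.inclusion (c.le_inertia ψ)) χ}

/-- The set of characters `SCh(𝓛)`. -/
def SCh {φ : H →* MulAut N} {𝓛 : CompatibleLattice H}
    (c : LittleGroupChoice φ 𝓛) (S : Set (N →* ℂˣ)) : Set (N ⋊[φ] H → ℂ) :=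
  {ζ | ∃ ψ ∈ S, ∃ ξ ∈ inducedSupercharacters c ψ, ζ = psiRtimes φ ψ (inertia φ ψ) ξ}

/-- The superclasses of `SCT(N)`, the supercharacter theory of `N` obtained from the action of the
inner automorphisms of `N ⋊[φ] H`: the orbits on `N`. -/
def orbitSuperclasses (φ : H →* MulAut N) : Set (Set N) :=
  {K | ∃ n : N, K = Set.range fun h : H => φ h n}

/-- The supercharacters of `SCT(N)`: the sums over the orbits on `Irr(N)`. -/
def orbitSupercharacters (φ : H →* MulAut N) : Set (N → ℂ) :=
  {f | ∃ ψ : N →* ℂˣ,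
    f = fun n => ∑ᶠ θ ∈ (Set.range fun h : H => conjLin φ h ψ), (θ n : ℂ)}

/-- The projection of `N ⋊[φ] H` onto `H`, the latter regarded as an element of the lattice. -/
def projTop (φ : H →* MulAut N) : N ⋊[φ] H →* (⊤ : Subgroup H) :=
  (Subgroup.topEquiv (G := H)).symm.toMonoidHom.comp SemidirectProduct.rightHom

/-- The superclasses of `SCT(N) * SCT(H)`. -/
def starNHSuperclasses (φ : H →* MulAut N) (𝓛 : CompatibleLattice H) :
    Set (Set (N ⋊[φ] H)) :=
  starSuperclasses SemidirectProduct.inl (projTop φ)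
    (orbitSuperclasses φ) (𝓛.theory ⊤ 𝓛.top_mem).superclasses

/-- The supercharacters of `SCT(N) * SCT(H)`. -/
def starNHSupercharacters (φ : H →* MulAut N) (𝓛 : CompatibleLattice H) :
    Set (N ⋊[φ] H → ℂ) :=
  starSupercharacters SemidirectProduct.inl (projTop φ)
    (orbitSupercharacters φ) (𝓛.theory ⊤ 𝓛.top_mem).supercharacters

end LittleGroups

end

/-!
Every question is translated into one about spaces of functions. In a supercharacter theory, each
irreducible character is a constituent of exactly one supercharacter, so the supercharacters are
pairwise orthogonal, and by the count `|𝒳| = |𝒦|` they span the space of all superclass functions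
(`SupercharacterTheory.span_supercharacters`). Hence the supercharacters determine the superclasses,
and one theory is finer than another if its span is larger. Conversely, pairwise orthogonal
characters whose span consists of the functions constant on the blocks of a partition, and contains
the indicator of `1`, are the supercharacters of a theory (`exists_supercharacterTheory`): two
orthogonal characters share no irreducible constituent, and the indicator of `1` has nonzero inner
product with every irreducible character. That the span comes from a partition is automatic for a
unital subalgebra (`exists_isPartition_blockFunctions_eq`). No Clifford theory is needed.

For `f : H → ℂ` let `conjSum φ ψ f` be the sum over `y : H` of the conjugates by `y` of
`n h ↦ ψ n * f h`. The members of `SCh(𝓛)` are, up to the factor `|H_ψ|⁻¹`, the functions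
`conjSum φ ψ f` with `f` the extension by zero of a supercharacter of `H_ψ` (`mem_SCh_iff`). Their
span is `LittleGroupChoice.superclassSpace`. It is closed under products, because a product of two
such sums is a sum of functions `conjSum φ (ψ ψ') g` with `g` supported on `H_ψ ∩ H_ψ' ≤ H_{ψψ'}`,
and `g` may be replaced by the function that it induces on `H_{ψψ'}`
(`LittleGroupChoice.mul_mem_superclassSpace`). Orthogonality of linear characters of `N` and of the
supercharacters of `H_ψ` gives the orthogonality of `SCh(𝓛)` (`charInner_SCh_eq_zero`), and Fourier
inversion on `N` puts the indicator of `1` into the span.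

The `*`-product belongs, up to positive factors, to the choice `H_ψ = 1` for all `ψ ≠ 1`
(`LittleGroupChoice.trivial`). Its span lies in that of `SCh(𝓛)` for every other choice. If the two
spans agree and `h ≠ 1` lies in `H_ψ` with `ψ ≠ 1`, then the function `conjSum φ ψ 1_{H_ψ}` is
constant on `N h`, yet there it is a nonempty sum of nontrivial characters of `N`
(`grp_eq_bot_of_superclassSpace_le`).
-/

noncomputable section

/-! ### Characters of finite groups -/

section Characters

variable {G : Type*} [Group G]

open scoped ComplexOrder in
/-- The trace of `ρ g⁻¹` is the conjugate of the trace of `ρ g`: averaging the standard Hermitian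
form gives a positive definite matrix `P` with `ρ(g)ᴴ P = P ρ(g⁻¹)`. -/
theorem Representation.character_inv_eq_star [Finite G] {n : ℕ}
    (ρ : Representation ℂ G (Fin n → ℂ)) (g : G) :
    ρ.character g⁻¹ = star (ρ.character g) := by
  classical
  have := Fintype.ofFinite G
  let A : G → Matrix (Fin n) (Fin n) ℂ := fun x => LinearMap.toMatrix' (ρ x)
  have hmul : ∀ x y, A (x * y) = A x * A y := fun x y => by
    simp [A, ← LinearMap.toMatrix'_mul]
  have hone : A 1 = 1 := by simp [A]
  have hchar : ∀ x, ρ.character x = (A x).trace := fun x => by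
    rw [Representation.character, LinearMap.trace_eq_matrix_trace ℂ (Pi.basisFun ℂ (Fin n))]
    rfl
  let P : Matrix (Fin n) (Fin n) ℂ := ∑ x : G, (A x).conjTranspose * A x
  have hP : P.PosDef := by
    -- The summand for `x = 1` is the identity matrix, and all others are positive semidefinite.
    have h : P = (A 1).conjTranspose * A 1 +
        ∑ x ∈ Finset.univ.erase (1 : G), (A x).conjTranspose * A x :=
      (Finset.add_sum_erase _ _ (Finset.mem_univ _)).symm
    rw [h, hone]
    refine Matrix.PosDef.add_posSemidef (by simpa using Matrix.PosDef.one) ?_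
    exact Matrix.posSemidef_sum _ fun x _ => Matrix.posSemidef_conjTranspose_mul_self _
  have hinv : (A g).conjTranspose * P * A g = P := by
    simp only [P, Finset.mul_sum, Finset.sum_mul]
    refine Fintype.sum_equiv (Equiv.mulRight g) _ _ fun x => ?_
    simp [hmul, Matrix.conjTranspose_mul, Matrix.mul_assoc]
  have hgg : A g * A g⁻¹ = 1 := by rw [← hmul, mul_inv_cancel, hone]
  have h1 : P * A g⁻¹ = (A g).conjTranspose * P := by
    conv_lhs => rw [← hinv]
    rw [Matrix.mul_assoc, hgg, Matrix.mul_one]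
  have hu : IsUnit P.det := (Matrix.isUnit_iff_isUnit_det P).mp hP.isUnit
  have h2 : A g⁻¹ = P⁻¹ * ((A g).conjTranspose * P) := by
    rw [← h1, ← Matrix.mul_assoc, Matrix.nonsing_inv_mul _ hu, Matrix.one_mul]
  rw [hchar, hchar, h2, Matrix.trace_mul_comm, Matrix.mul_assoc, Matrix.mul_nonsing_inv _ hu,
    Matrix.mul_one, Matrix.trace_conjTranspose]

theorem charInner_eq_sum [Fintype G] (f g : G → ℂ) :
    charInner f g = (Nat.card G : ℂ)⁻¹ * ∑ x : G, f x * star (g x) := by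
  rw [charInner, finsum_eq_sum_of_fintype]

theorem Representation.charInner_character [Finite G] {m n : ℕ}
    (ρ : Representation ℂ G (Fin m → ℂ)) (σ : Representation ℂ G (Fin n → ℂ)) :
    charInner σ.character ρ.character = Module.finrank ℂ (ρ.IntertwiningMap σ) := by
  have := Fintype.ofFinite G
  have : Invertible (Nat.card G : ℂ) := invertibleOfNonzero (by simp)
  rw [charInner_eq_sum, ← Representation.card_inv_mul_sum_char_mul_char_eq_finrank]
  simp [Representation.character_inv_eq_star]

theorem Representation.charInner_character_ne_zero_iff [Finite G] {m n : ℕ}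
    (ρ : Representation ℂ G (Fin m → ℂ)) (σ : Representation ℂ G (Fin n → ℂ)) :
    charInner σ.character ρ.character ≠ 0 ↔ ∃ f : ρ.IntertwiningMap σ, f ≠ 0 := by
  rw [Representation.charInner_character, Nat.cast_ne_zero, ← Nat.pos_iff_ne_zero,
    Module.finrank_pos_iff_exists_ne_zero]

theorem charInner_star [Finite G] (f g : G → ℂ) : star (charInner f g) = charInner g f := by
  have := Fintype.ofFinite G
  simp only [charInner_eq_sum, star_mul', star_sum, star_star]
  simp [mul_comm]

theorem charInner_eq_zero_comm [Finite G] {f g : G → ℂ} :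
    charInner f g = 0 ↔ charInner g f = 0 := by
  rw [← charInner_star f g, star_eq_zero]

section Transport

variable {V : Type*} [AddCommGroup V] [Module ℂ V] [Module.Finite ℂ V]

/-- Every finite-dimensional representation is equivalent to one on some `Fin n → ℂ`. -/
theorem Representation.exists_equiv_fin (ρ : Representation ℂ G V) :
    ∃ σ : Representation ℂ G (Fin (Module.finrank ℂ V) → ℂ), Nonempty (ρ.Equiv σ) := by
  let e : V ≃ₗ[ℂ] (Fin (Module.finrank ℂ V) → ℂ) := (Module.finBasis ℂ V).equivFun
  let σ : Representation ℂ G (Fin (Module.finrank ℂ V) → ℂ) :=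
    { toFun := fun g => e.conj (ρ g)
      map_one' := by ext; simp [LinearEquiv.conj_apply]
      map_mul' := fun x y => by
        ext; simp [LinearEquiv.conj_apply] }
  exact ⟨σ, ⟨Representation.Equiv.mk e fun g => by ext v; simp [σ, LinearEquiv.conj_apply]⟩⟩

theorem Representation.isCharacter_character [Nontrivial V] (ρ : Representation ℂ G V) :
    IsCharacter ρ.character := by
  obtain ⟨σ, ⟨e⟩⟩ := ρ.exists_equiv_fin
  exact ⟨_, σ, Module.finrank_pos.ne', Representation.char_iso e⟩

end Transport

theorem IsIrrCharacter.isCharacter {θ : G → ℂ} (h : IsIrrCharacter θ) : IsCharacter θ := by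
  obtain ⟨n, ρ, hρ, rfl⟩ := h
  refine ⟨n, ρ, ?_, rfl⟩
  rintro rfl
  have : (⊥ : Subrepresentation ρ) = ⊤ :=
    Subrepresentation.toSubmodule_injective (Subsingleton.elim _ _)
  exact bot_ne_top this

/-! ### Irreducible constituents -/

theorem Subrepresentation.isIrreducible_of_isAtom {V : Type*} [AddCommGroup V] [Module ℂ V]
    {ρ : Representation ℂ G V} {W : Subrepresentation ρ} (hW : IsAtom W) :
    W.toRepresentation.IsIrreducible := by
  have hne : Nontrivial (Subrepresentation W.toRepresentation) := by
    refine ⟨⊥, ⊤, fun h => hW.1 ?_⟩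
    refine eq_bot_iff.mpr fun x hx => ?_
    have h1 : (⟨x, hx⟩ : W.toSubmodule) ∈ (⊤ : Subrepresentation W.toRepresentation) :=
      Submodule.mem_top
    rw [← h] at h1
    have h2 : (⟨x, hx⟩ : W.toSubmodule) = 0 := (Submodule.mem_bot ℂ).mp h1
    exact (Submodule.mem_bot ℂ).mpr (congrArg Subtype.val h2)
  refine { toNontrivial := hne, eq_bot_or_eq_top := fun U => ?_ }
  let U' : Subrepresentation ρ :=
    { toSubmodule := U.toSubmodule.map W.toSubmodule.subtype
      apply_mem_toSubmodule := by
        rintro g _ ⟨u, hu, rfl⟩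
        exact ⟨_, U.apply_mem_toSubmodule g hu, rfl⟩ }
  have hle : U' ≤ W := by
    rintro _ ⟨u, _, rfl⟩
    exact u.2
  have key : ∀ u : W.toSubmodule, (u : V) ∈ U' ↔ u ∈ U := fun u =>
    ⟨by rintro ⟨u', hu', h⟩; rwa [← Subtype.ext h], fun hu => ⟨u, hu, rfl⟩⟩
  rcases hW.le_iff.mp hle with h | h
  · left
    refine eq_bot_iff.mpr fun u hu => ?_
    have h1 := (key u).mpr hu
    rw [h] at h1
    exact (Submodule.mem_bot ℂ).mpr (Subtype.ext ((Submodule.mem_bot ℂ).mp h1))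
  · right
    refine eq_top_iff.mpr fun u _ => (key u).mp ?_
    rw [h]
    exact u.2

theorem Subrepresentation.exists_isAtom_le [Finite G] {V : Type*} [AddCommGroup V] [Module ℂ V]
    {ρ : Representation ℂ G V} {C : Subrepresentation ρ} (hC : C ≠ ⊥) :
    ∃ W ≤ C, IsAtom W := by
  have : NeZero (Nat.card G : ℂ) := ⟨by simp [Nat.card_pos.ne']⟩
  have h : IsAtomic (Subrepresentation ρ) :=
    (OrderIso.isAtomic_iff Subrepresentation.subrepresentationSubmoduleOrderIso).mpr
      inferInstance
  obtain ⟨W, hW, hle⟩ := (h.eq_bot_or_exists_atom_le C).resolve_left hC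
  exact ⟨W, hle, hW⟩

theorem Representation.IsIrreducible.of_equiv {V W : Type*} [AddCommGroup V] [Module ℂ V]
    [AddCommGroup W] [Module ℂ W] {ρ : Representation ℂ G V} {σ : Representation ℂ G W}
    (e : ρ.Equiv σ) (h : ρ.IsIrreducible) : σ.IsIrreducible := by
  let φ : Subrepresentation σ → Subrepresentation ρ := fun U =>
    { toSubmodule := U.toSubmodule.comap e.toLinearEquiv.toLinearMap
      apply_mem_toSubmodule := fun g v hv => by
        have := U.apply_mem_toSubmodule g hv
        change e (ρ g v) ∈ U.toSubmodule
        rwa [show e (ρ g v) = σ g (e v) from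
          Representation.IntertwiningMap.isIntertwining _ _ e.toIntertwiningMap g v] }
  have key : ∀ (U : Subrepresentation σ) (w : W), e.toLinearEquiv.symm w ∈ φ U ↔ w ∈ U := by
    intro U w
    change e.toLinearEquiv (e.toLinearEquiv.symm w) ∈ U.toSubmodule ↔ w ∈ U
    rw [LinearEquiv.apply_symm_apply]
    rfl
  have hbot : ∀ U, φ U = ⊥ → U = ⊥ := fun U hU => eq_bot_iff.mpr fun w hw => by
    have h1 := (key U w).mpr hw
    rw [hU] at h1
    exact (Submodule.mem_bot ℂ).mpr
      (e.toLinearEquiv.symm.map_eq_zero_iff.mp ((Submodule.mem_bot ℂ).mp h1))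
  have htop : ∀ U, φ U = ⊤ → U = ⊤ := fun U hU => eq_top_iff.mpr fun w _ => by
    rw [← key U w, hU]
    exact Submodule.mem_top
  have hne : Nontrivial (Subrepresentation σ) := by
    refine ⟨⊥, ⊤, fun h0 => bot_ne_top (α := Subrepresentation ρ) (Eq.symm ?_)⟩
    refine eq_bot_iff.mpr fun v _ => (Submodule.mem_bot ℂ).mpr ?_
    have h1 : e.toLinearEquiv v ∈ (⊤ : Subrepresentation σ) := Submodule.mem_top
    rw [← h0] at h1
    exact e.toLinearEquiv.map_eq_zero_iff.mp ((Submodule.mem_bot ℂ).mp h1)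
  exact { toNontrivial := hne
          eq_bot_or_eq_top := fun U => (eq_bot_or_eq_top (φ U)).imp (hbot U) (htop U) }

/-- Two characters that are not orthogonal have a common irreducible constituent: a nonzero
intertwining map is injective on a complement of its kernel, which by Maschke's theorem may be
taken to be a subrepresentation. -/
theorem exists_common_constituent [Finite G] {χ χ' : G → ℂ} (h : IsCharacter χ)
    (h' : IsCharacter χ') (hne : charInner χ χ' ≠ 0) :
    ∃ θ, IsIrrCharacter θ ∧ IsConstituent θ χ ∧ IsConstituent θ χ' := by
  obtain ⟨n, σ, _, rfl⟩ := h
  obtain ⟨m, ρ, _, rfl⟩ := h'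
  obtain ⟨f, hf⟩ := (Representation.charInner_character_ne_zero_iff ρ σ).mp hne
  have : NeZero (Nat.card G : ℂ) := ⟨by simp [Nat.card_pos.ne']⟩
  obtain ⟨C, hC⟩ := exists_isCompl f.ker
  have hCne : C ≠ ⊥ := by
    rintro rfl
    refine hf (DFunLike.ext _ _ fun v => ?_)
    have h1 : f.ker = ⊤ := by simpa using hC.sup_eq_top
    have h2 : v ∈ f.ker := by rw [h1]; exact Submodule.mem_top
    exact (Representation.IntertwiningMap.mem_ker _ _ f v).mp h2
  obtain ⟨W, hWC, hW⟩ := Subrepresentation.exists_isAtom_le hCne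
  obtain ⟨τ, ⟨e⟩⟩ := W.toRepresentation.exists_equiv_fin
  have hirr := Representation.IsIrreducible.of_equiv e
    (Subrepresentation.isIrreducible_of_isAtom hW)
  let incl : W.toRepresentation.IntertwiningMap ρ :=
    { toLinearMap := W.toSubmodule.subtype
      isIntertwining' := fun g => rfl }
  obtain ⟨w, hw, hw0⟩ : ∃ w ∈ W, w ≠ 0 := by
    by_contra! hcon
    exact hW.1 (eq_bot_iff.mpr fun x hx => (Submodule.mem_bot ℂ).mpr (hcon x hx))
  have hval : incl (e.symm (e ⟨w, hw⟩)) = w := by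
    rw [show e.symm (e ⟨w, hw⟩) = ⟨w, hw⟩ from e.toLinearEquiv.symm_apply_apply _]
    rfl
  refine ⟨τ.character, ⟨_, τ, hirr, rfl⟩, ?_, ?_⟩
  · refine (Representation.charInner_character_ne_zero_iff τ σ).mpr
      ⟨(f.comp incl).comp e.symm.toIntertwiningMap, fun h0 => hw0 ?_⟩
    have h1 : f w = 0 := by
      rw [← hval]
      exact DFunLike.congr_fun h0 (e ⟨w, hw⟩)
    have h2 : w ∈ f.ker ⊓ C := ⟨(Representation.IntertwiningMap.mem_ker _ _ f w).mpr h1, hWC hw⟩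
    rw [hC.inf_eq_bot] at h2
    exact (Submodule.mem_bot ℂ).mp h2
  · refine (Representation.charInner_character_ne_zero_iff τ ρ).mpr
      ⟨incl.comp e.symm.toIntertwiningMap, fun h0 => hw0 ?_⟩
    rw [← hval]
    exact DFunLike.congr_fun h0 (e ⟨w, hw⟩)

theorem IsCharacter.charInner_self_ne_zero [Finite G] {χ : G → ℂ} (h : IsCharacter χ) :
    charInner χ χ ≠ 0 := by
  obtain ⟨n, ρ, hn, rfl⟩ := h
  refine (Representation.charInner_character_ne_zero_iff ρ ρ).mpr ⟨.id ρ, fun h0 => ?_⟩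
  have : NeZero n := ⟨hn⟩
  have h1 := congrFun (DFunLike.congr_fun h0 (fun _ => 1)) 0
  simp at h1

/-- Orthogonal characters have no common irreducible constituent `θ`: an intertwining map onto `θ`
followed by one out of `θ` is nonzero. -/
theorem charInner_ne_zero_of_common_constituent [Finite G] {χ χ' θ : G → ℂ} (h : IsCharacter χ)
    (h' : IsCharacter χ') (hθ : IsIrrCharacter θ) (hχ : IsConstituent θ χ)
    (hχ' : IsConstituent θ χ') : charInner χ χ' ≠ 0 := by
  obtain ⟨n, σ, _, rfl⟩ := h
  obtain ⟨m, ρ, _, rfl⟩ := h'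
  obtain ⟨l, τ, hτ, rfl⟩ := hθ
  obtain ⟨f, hf⟩ := (Representation.charInner_character_ne_zero_iff τ σ).mp hχ
  obtain ⟨g, hg⟩ := (Representation.charInner_character_ne_zero_iff ρ τ).mp
    (mt charInner_eq_zero_comm.mpr hχ')
  refine (Representation.charInner_character_ne_zero_iff ρ σ).mpr ⟨f.comp g, fun h0 => hf ?_⟩
  have hs := (Representation.IsIrreducible.surjective_or_eq_zero g).resolve_right hg
  refine DFunLike.ext _ _ fun v => ?_
  obtain ⟨u, rfl⟩ := hs v
  exact DFunLike.congr_fun h0 u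

theorem IsCharacter.apply_one_pos {χ : G → ℂ} (h : IsCharacter χ) :
    ∃ n : ℕ, 0 < n ∧ χ 1 = n := by
  obtain ⟨n, ρ, hn, rfl⟩ := h
  exact ⟨n, Nat.pos_of_ne_zero hn, by simp⟩

theorem IsCharacter.conj {χ : G → ℂ} (h : IsCharacter χ) (g x : G) : χ (g * x * g⁻¹) = χ x := by
  obtain ⟨n, ρ, hn, rfl⟩ := h
  exact Representation.char_conj ρ x g

/-! ### Constructions of characters -/

theorem IsCharacter.comp {H : Type*} [Group H] {χ : G → ℂ} (h : IsCharacter χ) (f : H →* G) :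
    IsCharacter fun x => χ (f x) := by
  obtain ⟨n, ρ, hn, rfl⟩ := h
  exact ⟨n, ρ.comp f, hn, rfl⟩

theorem IsCharacter.add {χ χ' : G → ℂ} (h : IsCharacter χ) (h' : IsCharacter χ') :
    IsCharacter (χ + χ') := by
  obtain ⟨n, ρ, hn, rfl⟩ := h
  obtain ⟨m, σ, hm, rfl⟩ := h'
  have : NeZero n := ⟨hn⟩
  have hc : ρ.character + σ.character = (ρ.prod σ).character := by
    ext x
    exact (LinearMap.trace_prodMap' (ρ x) (σ x)).symm
  rw [hc]
  exact Representation.isCharacter_character _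

theorem IsCharacter.nsmul {χ : G → ℂ} (h : IsCharacter χ) {k : ℕ} (hk : 0 < k) :
    IsCharacter ((k : ℂ) • χ) := by
  induction k, hk using Nat.le_induction with
  | base => simpa using h
  | succ k hk ih =>
    have := ih.add h
    rwa [show ((k + 1 : ℕ) : ℂ) • χ = (k : ℂ) • χ + χ by push_cast; rw [add_smul, one_smul]]

theorem IsCharacter.linear_mul {χ : G → ℂ} (h : IsCharacter χ) (μ : G →* ℂˣ) :
    IsCharacter fun x => (μ x : ℂ) * χ x := by
  obtain ⟨n, ρ, hn, rfl⟩ := h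
  let σ : Representation ℂ G (Fin n → ℂ) :=
    { toFun := fun g => (μ g : ℂ) • ρ g
      map_one' := by simp
      map_mul' := fun x y => by ext; simp [mul_assoc, mul_left_comm] }
  refine ⟨n, σ, hn, funext fun x => ?_⟩
  simp [Representation.character, σ]

end Characters

/-! ### Induced characters -/

section Induction

variable {A B : Type*} [Group A] [Group B]

open Classical in
theorem indFun_eq_sum [Fintype A] [Fintype B] (i : A →* B) (χ : A → ℂ) (b : B) :
    indFun i χ b =
      (Nat.card A : ℂ)⁻¹ * ∑ x : B, ∑ a : A, if i a = x * b * x⁻¹ then χ a else 0 := by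
  rw [indFun, finsum_eq_sum_of_fintype]
  congr 1
  refine Finset.sum_congr rfl fun x _ => ?_
  rw [finsum_eq_sum_of_fintype]
  refine Finset.sum_congr rfl fun a _ => ?_
  rw [finsum_eq_if]

/-- The action of `A` on functions `B → V` by `(a • f) x = ρ a (f ((i a)⁻¹ x))`. Its invariants
form the representation of `B` induced from `ρ`. -/
def Representation.twistedFun {V : Type*} [AddCommGroup V] [Module ℂ V] (i : A →* B)
    (ρ : Representation ℂ A V) : Representation ℂ A (B → V) where
  toFun a :=
    { toFun := fun f x => ρ a (f ((i a)⁻¹ * x))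
      map_add' := fun f g => by ext; simp
      map_smul' := fun c f => by ext; simp }
  map_one' := by ext; simp
  map_mul' a a' := by
    refine LinearMap.ext fun f => funext fun x => ?_
    simp [mul_assoc]

/-- The representation of `B` induced from `ρ`: right translation on the `A`-equivariant
functions `B → V`. -/
def Representation.inducedRep {V : Type*} [AddCommGroup V] [Module ℂ V] (i : A →* B)
    (ρ : Representation ℂ A V) : Representation ℂ B (ρ.twistedFun i).invariants where
  toFun b := (LinearMap.funLeft ℂ V (· * b)).restrict (fun f hf a => by
    funext x
    have := congrFun (hf a) (x * b)
    simpa [Representation.twistedFun, LinearMap.funLeft, mul_assoc] using this)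
  map_one' := by
    refine LinearMap.ext fun f => Subtype.ext (funext fun x => ?_)
    simp [LinearMap.funLeft]
  map_mul' b b' := by
    refine LinearMap.ext fun f => Subtype.ext (funext fun x => ?_)
    simp [LinearMap.funLeft, mul_assoc]

open Classical in
theorem trace_funLeft_comp_twistedFun [Fintype B] {n : ℕ} (i : A →* B)
    (ρ : Representation ℂ A (Fin n → ℂ)) (a : A) (b : B) :
    LinearMap.trace ℂ _ (LinearMap.funLeft ℂ (Fin n → ℂ) (· * b) ∘ₗ ρ.twistedFun i a) =
      ∑ x : B, if i a = x * b * x⁻¹ then ρ.character a else 0 := by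
  rw [LinearMap.trace_eq_matrix_trace ℂ (Pi.basis fun _ : B => Pi.basisFun ℂ (Fin n)),
    Matrix.trace, Fintype.sum_sigma]
  refine Finset.sum_congr rfl fun x _ => ?_
  have hiff : i a = x * b * x⁻¹ ↔ (i a)⁻¹ * (x * b) = x := by
    rw [eq_mul_inv_iff_mul_eq, inv_mul_eq_iff_eq_mul, eq_comm]
  rw [hiff, Representation.character,
    LinearMap.trace_eq_matrix_trace ℂ (Pi.basisFun ℂ (Fin n)), Matrix.trace]
  split_ifs with h
  · refine Finset.sum_congr rfl fun j _ => ?_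
    simp [LinearMap.toMatrix_apply, Representation.twistedFun, LinearMap.funLeft, Pi.basis_repr, h]
  · refine Finset.sum_eq_zero fun j _ => ?_
    simp [LinearMap.toMatrix_apply, Representation.twistedFun, LinearMap.funLeft, Pi.basis_repr,
      Pi.single_apply, h]

/-- The trace on the invariants of `A` is the trace of the composition with the averaging
projection, which is the defining formula of `indFun`. -/
theorem Representation.character_inducedRep [Finite A] [Finite B] {n : ℕ} (i : A →* B)
    (ρ : Representation ℂ A (Fin n → ℂ)) : (ρ.inducedRep i).character = indFun i ρ.character := by
  classical
  have := Fintype.ofFinite A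
  have := Fintype.ofFinite B
  have : Invertible (Fintype.card A : ℂ) := invertibleOfNonzero (by simp)
  funext b
  let T : (B → Fin n → ℂ) →ₗ[ℂ] (B → Fin n → ℂ) := LinearMap.funLeft ℂ (Fin n → ℂ) (· * b)
  have hP := (ρ.twistedFun i).isProj_averageMap
  have h1 : (ρ.inducedRep i b) =
      (ρ.inducedRep i b ∘ₗ hP.codRestrict) ∘ₗ (ρ.twistedFun i).invariants.subtype := by
    refine LinearMap.ext fun f => ?_
    simp [-Representation.averageMap]
  have h2 : (ρ.twistedFun i).invariants.subtype ∘ₗ (ρ.inducedRep i b ∘ₗ hP.codRestrict) =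
      T ∘ₗ (ρ.twistedFun i).averageMap := rfl
  rw [Representation.character, h1, LinearMap.trace_comp_comm', h2, indFun_eq_sum,
    Finset.sum_comm]
  have h3 : (ρ.twistedFun i).averageMap =
      (Nat.card A : ℂ)⁻¹ • ∑ a : A, ρ.twistedFun i a := by
    simp [Representation.averageMap, GroupAlgebra.average]
  rw [h3, LinearMap.comp_smul, map_smul, ← Module.End.mul_eq_comp, Finset.mul_sum, map_sum,
    smul_eq_mul]
  congr 1
  exact Finset.sum_congr rfl fun a _ => trace_funLeft_comp_twistedFun i ρ a b

theorem IsCharacter.indFun [Finite A] [Finite B] {i : A →* B} (hi : Function.Injective i)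
    {χ : A → ℂ} (h : IsCharacter χ) : IsCharacter (indFun i χ) := by
  classical
  have := Fintype.ofFinite A
  have := Fintype.ofFinite B
  obtain ⟨n, ρ, hn, rfl⟩ := h
  rw [← Representation.character_inducedRep]
  -- The value of the induced character at `1` is not zero.
  have hdim : Nontrivial (ρ.twistedFun i).invariants := by
    by_contra hcon
    rw [not_nontrivial_iff_subsingleton] at hcon
    have h1 : (ρ.inducedRep i).character 1 = 0 := by
      rw [Representation.char_one, Module.finrank_zero_of_subsingleton, Nat.cast_zero]
    rw [Representation.character_inducedRep, indFun_eq_sum] at h1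
    simp [map_eq_one_iff i hi, hn] at h1
  exact Representation.isCharacter_character _

end Induction

/-! ### Functions constant on the blocks of a partition -/

section Blocks

variable {α : Type*}

/-- The space of functions that are constant on the blocks of `𝒦`. -/
def blockFunctions (𝒦 : Set (Set α)) : Submodule ℂ (α → ℂ) where
  carrier := {f | IsConstantOnBlocks 𝒦 f}
  zero_mem' := fun _ _ _ _ _ _ => rfl
  add_mem' := fun hf hg K hK x hx y hy => by
    simp only [Pi.add_apply, hf K hK x hx y hy, hg K hK x hx y hy]
  smul_mem' := fun c f hf K hK x hx y hy => by
    simp only [Pi.smul_apply, hf K hK x hx y hy]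

theorem mem_blockFunctions {𝒦 : Set (Set α)} {f : α → ℂ} :
    f ∈ blockFunctions 𝒦 ↔ IsConstantOnBlocks 𝒦 f := Iff.rfl

theorem Setoid.IsPartition.eq_of_mem {𝒦 : Set (Set α)} (h : Setoid.IsPartition 𝒦) {K K' : Set α}
    (hK : K ∈ 𝒦) (hK' : K' ∈ 𝒦) {x : α} (hx : x ∈ K) (hx' : x ∈ K') : K = K' :=
  (h.2 x).unique ⟨hK, hx⟩ ⟨hK', hx'⟩

theorem Setoid.IsPartition.indicator_mem_blockFunctions {𝒦 : Set (Set α)}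
    (h : Setoid.IsPartition 𝒦) {K : Set α} (hK : K ∈ 𝒦) :
    K.indicator 1 ∈ blockFunctions 𝒦 := by
  classical
  intro L hL x hx y hy
  have key : ∀ z ∈ L, (z ∈ K ↔ L = K) := fun z hz =>
    ⟨fun hzK => h.eq_of_mem hL hK hz hzK, fun e => e ▸ hz⟩
  simp only [Set.indicator_apply, key x hx, key y hy]
  rfl

/-- More functions are constant on the blocks of a finer partition, and conversely. -/
theorem exists_subset_of_blockFunctions_le {𝒦 𝒦' : Set (Set α)} (h : Setoid.IsPartition 𝒦)
    (h' : Setoid.IsPartition 𝒦') (hle : blockFunctions 𝒦' ≤ blockFunctions 𝒦) :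
    ∀ K ∈ 𝒦, ∃ K' ∈ 𝒦', K ⊆ K' := by
  classical
  intro K hK
  obtain ⟨x, hx⟩ := Setoid.nonempty_of_mem_partition h hK
  obtain ⟨K', ⟨hK', hxK'⟩, _⟩ := h'.2 x
  refine ⟨K', hK', fun y hy => ?_⟩
  have h1 := hle (h'.indicator_mem_blockFunctions hK') K hK x hx y hy
  by_contra hy'
  simp [hxK', hy'] at h1

theorem eq_of_blockFunctions_eq {𝒦 𝒦' : Set (Set α)} (h : Setoid.IsPartition 𝒦)
    (h' : Setoid.IsPartition 𝒦') (heq : blockFunctions 𝒦 = blockFunctions 𝒦') : 𝒦 = 𝒦' := by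
  have key : ∀ {𝒦 𝒦' : Set (Set α)}, Setoid.IsPartition 𝒦 → Setoid.IsPartition 𝒦' →
      blockFunctions 𝒦 = blockFunctions 𝒦' → 𝒦 ⊆ 𝒦' := by
    intro 𝒦 𝒦' h h' heq K hK
    obtain ⟨K', hK', hle⟩ := exists_subset_of_blockFunctions_le h h' heq.ge K hK
    obtain ⟨K'', hK'', hle'⟩ := exists_subset_of_blockFunctions_le h' h heq.le K' hK'
    obtain ⟨x, hx⟩ := Setoid.nonempty_of_mem_partition h hK
    have : K = K'' := h.eq_of_mem hK hK'' hx (hle' (hle hx))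
    subst this
    rwa [hle.antisymm hle']
  exact (key h h' heq).antisymm (key h' h heq.symm)

theorem finrank_blockFunctions [Finite α] {𝒦 : Set (Set α)} (h : Setoid.IsPartition 𝒦) :
    Module.finrank ℂ (blockFunctions 𝒦) = 𝒦.ncard := by
  classical
  have := Fintype.ofFinite α
  have := Fintype.ofFinite 𝒦
  choose b hb _ using h.2
  let L : (𝒦 → ℂ) →ₗ[ℂ] (α → ℂ) := LinearMap.funLeft ℂ ℂ fun x => ⟨b x, (hb x).1⟩
  have hb' : ∀ K : 𝒦, ∀ x ∈ K.1, (⟨b x, (hb x).1⟩ : 𝒦) = K := fun K x hx =>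
    Subtype.ext (h.eq_of_mem (hb x).1 K.2 (hb x).2 hx)
  have hinj : Function.Injective L := by
    refine LinearMap.funLeft_injective_of_surjective ℂ ℂ _ fun K => ?_
    obtain ⟨x, hx⟩ := Setoid.nonempty_of_mem_partition h K.2
    exact ⟨x, hb' K x hx⟩
  have hrange : LinearMap.range L = blockFunctions 𝒦 := by
    ext f
    constructor
    · rintro ⟨F, rfl⟩ K hK x hx y hy
      simp only [L, LinearMap.funLeft_apply, hb' ⟨K, hK⟩ x hx, hb' ⟨K, hK⟩ y hy]
    · intro hf
      refine ⟨fun K => f (Setoid.nonempty_of_mem_partition h K.2).choose, funext fun x => ?_⟩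
      exact hf _ (hb x).1 _ (Setoid.nonempty_of_mem_partition h (hb x).1).choose_spec _ (hb x).2
  rw [← hrange, LinearMap.finrank_range_of_inj hinj, Module.finrank_fintype_fun_eq_card,
    Set.ncard_eq_toFinset_card', Set.toFinset_card]

/-- A unital subalgebra of the functions on a finite set consists of the functions that are
constant on the blocks of a partition: two points lie in one block if the subalgebra does not
separate them, and a product of affine functions of members is the indicator of a block. -/
theorem exists_isPartition_blockFunctions_eq [Finite α] (V : Submodule ℂ (α → ℂ)) (h1 : 1 ∈ V)
    (hmul : ∀ f ∈ V, ∀ g ∈ V, f * g ∈ V) :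
    ∃ 𝒦 : Set (Set α), Setoid.IsPartition 𝒦 ∧ blockFunctions 𝒦 = V := by
  classical
  have := Fintype.ofFinite α
  let r : Setoid α :=
    { r := fun x y => ∀ f ∈ V, f x = f y
      iseqv := ⟨fun _ _ _ => rfl, fun h f hf => (h f hf).symm,
        fun h h' f hf => (h f hf).trans (h' f hf)⟩ }
  have hr : ∀ x y, r x y ↔ ∀ f ∈ V, f x = f y := fun _ _ => Iff.rfl
  have hprod : ∀ (s : Finset α) (F : α → α → ℂ), (∀ y ∈ s, F y ∈ V) → ∏ y ∈ s, F y ∈ V := by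
    intro s F
    induction s using Finset.induction_on with
    | empty => intro _; simpa using h1
    | insert a s ha ih =>
      intro hF
      rw [Finset.prod_insert ha]
      exact hmul _ (hF a (Finset.mem_insert_self a s)) _
        (ih fun y hy => hF y (Finset.mem_insert_of_mem hy))
  have hsep : ∀ x y, ¬ r x y → ∃ f ∈ V, f x = 1 ∧ f y = 0 := by
    intro x y hxy
    rw [hr] at hxy
    push Not at hxy
    obtain ⟨f, hf, hne⟩ := hxy
    refine ⟨(f x - f y)⁻¹ • (f - f y • 1), V.smul_mem _ (V.sub_mem hf (V.smul_mem _ h1)), ?_, ?_⟩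
    · simp [sub_ne_zero.mpr hne]
    · simp
  -- The indicator of a class is a product of functions separating it from the other points.
  have hind : ∀ x, {y | r y x}.indicator 1 ∈ V := by
    intro x
    choose! F hFV hFx hFy using hsep x
    have : ({y | r y x}.indicator 1 : α → ℂ) =
        ∏ y ∈ Finset.univ.filter (fun y => ¬ r x y), F y := by
      funext z
      rw [Finset.prod_apply]
      by_cases hz : r z x
      · rw [Set.indicator_of_mem (by exact hz), Finset.prod_eq_one]
        · rfl
        · intro y hy
          rw [hz _ (hFV y (Finset.mem_filter.mp hy).2), hFx y (Finset.mem_filter.mp hy).2]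
      · rw [Set.indicator_of_notMem (by exact hz)]
        have hz' : ¬ r x z := fun h => hz (r.symm h)
        have hmem : z ∈ Finset.univ.filter fun y => ¬ r x y :=
          Finset.mem_filter.mpr ⟨Finset.mem_univ z, hz'⟩
        exact (Finset.prod_eq_zero (f := fun y => F y z) hmem (hFy z hz')).symm
    rw [this]
    exact hprod _ _ fun y hy => hFV y (Finset.mem_filter.mp hy).2
  refine ⟨r.classes, r.isPartition_classes, le_antisymm ?_ ?_⟩
  · intro f hf
    have hfin : r.classes.Finite := Set.toFinite _
    have hsum : f = ∑ K ∈ hfin.toFinset, (fun x => if x ∈ K then f x else 0) := by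
      funext x
      rw [Finset.sum_apply, Finset.sum_eq_single {y | r y x}]
      · simp
      · intro K hK hne
        rw [if_neg]
        intro hx
        exact hne (r.isPartition_classes.eq_of_mem (hfin.mem_toFinset.mp hK) (r.mem_classes x) hx
          (r.refl x))
      · intro hx
        exact absurd (hfin.mem_toFinset.mpr (r.mem_classes x)) hx
    rw [hsum]
    refine V.sum_mem fun K hK => ?_
    obtain ⟨x, rfl⟩ := hfin.mem_toFinset.mp hK
    have : (fun y => if y ∈ {y | r y x} then f y else 0) = f x • {y | r y x}.indicator 1 := by
      funext y
      by_cases hy : r y x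
      · have h2 : f y = f x := hf _ (r.mem_classes x) y hy x (r.refl x)
        simp [hy, h2]
      · simp [hy]
    rw [this]
    exact V.smul_mem _ (hind x)
  · rintro f hf _ ⟨z, rfl⟩ x hx y hy
    exact (hx f hf).trans (hy f hf).symm

end Blocks

/-! ### Supercharacter theories and the spaces spanned by their supercharacters -/

section Theories

variable {G : Type*} [Group G]

theorem charInner_sum_left [Finite G] {ι : Type*} (s : Finset ι) (a : ι → ℂ) (F : ι → G → ℂ)
    (g : G → ℂ) : charInner (∑ j ∈ s, a j • F j) g = ∑ j ∈ s, a j * charInner (F j) g := by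
  have := Fintype.ofFinite G
  simp only [charInner_eq_sum, Finset.sum_apply, Pi.smul_apply, smul_eq_mul, Finset.sum_mul,
    Finset.mul_sum]
  rw [Finset.sum_comm]
  refine Finset.sum_congr rfl fun j _ => Finset.sum_congr rfl fun x _ => ?_
  ring

theorem charInner_smul_smul {G : Type*} [Group G] [Finite G] (a b : ℂ) {f g : G → ℂ}
    (h : charInner f g = 0) : charInner (a • f) (b • g) = 0 := by
  have := Fintype.ofFinite G
  rw [charInner_eq_sum] at h ⊢
  have : ∑ x, (a • f) x * star ((b • g) x) = a * star b * ∑ x, f x * star (g x) := by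
    rw [Finset.mul_sum]
    refine Finset.sum_congr rfl fun x _ => ?_
    simp only [Pi.smul_apply, smul_eq_mul, star_mul']
    ring
  rw [this, mul_left_comm, h, mul_zero]

theorem SupercharacterTheory.charInner_eq_zero [Finite G] (T : SupercharacterTheory G)
    {χ χ' : G → ℂ} (h : χ ∈ T.supercharacters) (h' : χ' ∈ T.supercharacters) (hne : χ ≠ χ') :
    charInner χ χ' = 0 := by
  by_contra h0
  obtain ⟨θ, hθ, h1, h2⟩ :=
    exists_common_constituent (T.isCharacter χ h) (T.isCharacter χ' h') h0
  exact hne ((T.existsUnique_constituent θ hθ).unique ⟨h, h1⟩ ⟨h', h2⟩)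

/-- Pairwise orthogonal characters are linearly independent. -/
theorem linearIndepOn_of_charInner_eq_zero [Finite G] {X : Set (G → ℂ)}
    (hX : ∀ χ ∈ X, IsCharacter χ)
    (horth : ∀ χ ∈ X, ∀ χ' ∈ X, χ ≠ χ' → charInner χ χ' = 0) :
    LinearIndependent ℂ (Subtype.val : X → G → ℂ) := by
  classical
  rw [linearIndependent_iff']
  intro s a hsum χ hχ
  have h1 := charInner_sum_left s a Subtype.val χ.1
  rw [hsum, Finset.sum_eq_single χ] at h1
  · have h0 : charInner (0 : G → ℂ) χ.1 = 0 := by simp [charInner]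
    rw [h0] at h1
    exact (mul_eq_zero.mp h1.symm).resolve_right (hX χ χ.2).charInner_self_ne_zero
  · intro χ' _ hne
    rw [horth χ'.1 χ'.2 χ.1 χ.2 fun h => hne (Subtype.ext h), mul_zero]
  · exact fun h => absurd hχ h

theorem finrank_span_of_charInner_eq_zero [Finite G] {X : Set (G → ℂ)}
    (hX : ∀ χ ∈ X, IsCharacter χ)
    (horth : ∀ χ ∈ X, ∀ χ' ∈ X, χ ≠ χ' → charInner χ χ' = 0) :
    Module.finrank ℂ (Submodule.span ℂ X) = X.ncard := by
  have hli := linearIndepOn_of_charInner_eq_zero hX horth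
  have := hli.finite
  have := Fintype.ofFinite X
  rw [Set.ncard_eq_toFinset_card']
  exact finrank_span_set_eq_card hli

/-- The supercharacters span the space of superclass functions: both dimensions equal the number of
superclasses. -/
theorem SupercharacterTheory.span_supercharacters [Finite G] (T : SupercharacterTheory G) :
    Submodule.span ℂ T.supercharacters = blockFunctions T.superclasses := by
  refine Submodule.eq_of_le_of_finrank_eq (Submodule.span_le.mpr T.constant) ?_
  rw [finrank_span_of_charInner_eq_zero T.isCharacter fun χ h χ' h' => T.charInner_eq_zero h h',
    finrank_blockFunctions T.isPartition, T.card_eq]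

theorem SupercharacterTheory.superclasses_eq_iff [Finite G] (T T' : SupercharacterTheory G) :
    T.superclasses = T'.superclasses ↔
      Submodule.span ℂ T.supercharacters = Submodule.span ℂ T'.supercharacters := by
  rw [T.span_supercharacters, T'.span_supercharacters]
  exact ⟨fun h => by rw [h], eq_of_blockFunctions_eq T.isPartition T'.isPartition⟩

theorem SupercharacterTheory.isFinerThan_of_span_le [Finite G] {T T' : SupercharacterTheory G}
    (h : Submodule.span ℂ T'.supercharacters ≤ Submodule.span ℂ T.supercharacters) :
    T.IsFinerThan T' := by
  rw [T.span_supercharacters, T'.span_supercharacters] at h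
  exact exists_subset_of_blockFunctions_le T.isPartition T'.isPartition h

/-- A supercharacter theory is determined by its supercharacters. -/
theorem SupercharacterTheory.eq_of_supercharacters_eq [Finite G] {T T' : SupercharacterTheory G}
    (h : T.supercharacters = T'.supercharacters) : T = T' := by
  have h1 := (T.superclasses_eq_iff T').mpr (by rw [h])
  cases T
  cases T'
  simp only at h h1
  subst h h1
  rfl

/-- A criterion for supercharacter theories. Orthogonality of the members of `X` makes each
irreducible character a constituent of at most one of them. As the inner product with the
indicator of `1` is evaluation at `1` up to a factor, each is a constituent of at least one. -/
theorem exists_supercharacterTheory [Finite G] {X : Set (G → ℂ)} {𝒦 : Set (Set G)}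
    (hX : ∀ χ ∈ X, IsCharacter χ)
    (horth : ∀ χ ∈ X, ∀ χ' ∈ X, χ ≠ χ' → charInner χ χ' = 0)
    (h𝒦 : Setoid.IsPartition 𝒦) (hspan : Submodule.span ℂ X = blockFunctions 𝒦)
    (hone : ({1} : Set G).indicator 1 ∈ Submodule.span ℂ X) :
    ∃ T : SupercharacterTheory G, T.superclasses = 𝒦 ∧ T.supercharacters = X := by
  classical
  have := Fintype.ofFinite G
  have hconj : ∀ f ∈ Submodule.span ℂ X, ∀ g x, f (g * x * g⁻¹) = f x := by
    intro f hf g x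
    induction hf using Submodule.span_induction with
    | mem χ h => exact (hX χ h).conj g x
    | zero => rfl
    | add f f' _ _ h h' => simp only [Pi.add_apply, h, h']
    | smul c f _ h => simp only [Pi.smul_apply, h]
  refine ⟨⟨𝒦, X, h𝒦, ?_, hX, ?_, ?_, ?_⟩, rfl, rfl⟩
  · intro K hK x hx g
    have h1 := hconj _ (hspan ▸ h𝒦.indicator_mem_blockFunctions hK) g x
    by_contra h2
    simp [hx, h2] at h1
  · rw [← finrank_blockFunctions h𝒦, ← hspan, finrank_span_of_charInner_eq_zero hX horth]
  · intro χ hχ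
    have : χ ∈ blockFunctions 𝒦 := hspan ▸ Submodule.subset_span hχ
    exact this
  · intro θ hθ
    have hex : ∃ χ ∈ X, IsConstituent θ χ := by
      by_contra! hcon
      have h0 : ∀ f ∈ Submodule.span ℂ X, charInner f θ = 0 := by
        intro f hf
        obtain ⟨l, hl, rfl⟩ := (Finsupp.mem_span_iff_linearCombination ℂ X f).mp hf
        rw [Finsupp.linearCombination_apply, Finsupp.sum, charInner_sum_left]
        exact Finset.sum_eq_zero fun χ _ => by
          rw [not_not.mp (hcon χ.1 χ.2), mul_zero]
      have h1 := h0 _ hone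
      obtain ⟨n, hn, hn1⟩ := hθ.isCharacter.apply_one_pos
      rw [charInner_eq_sum, Finset.sum_eq_single 1] at h1
      · simp [hn1, hn.ne'] at h1
      · intro x _ hx
        simp [hx]
      · simp
    obtain ⟨χ, hχ, hc⟩ := hex
    refine ⟨χ, ⟨hχ, hc⟩, fun χ' h => ?_⟩
    by_contra hne
    exact charInner_ne_zero_of_common_constituent (hX χ' h.1) (hX χ hχ) hθ h.2 hc
      (horth χ' h.1 χ hχ hne)

end Theories

/-! ### Superclass functions of the members of a compatible lattice, extended by zero -/

theorem sum_ite_eq_extend {A B : Type*} [Fintype A] [DecidableEq B] {i : A → B}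
    (hi : Function.Injective i) (χ : A → ℂ) (b : B) :
    ∑ a : A, (if i a = b then χ a else 0) = Function.extend i χ 0 b := by
  by_cases hb : ∃ a, i a = b
  · obtain ⟨a, rfl⟩ := hb
    rw [hi.extend_apply, Finset.sum_eq_single a]
    · simp
    · intro a' _ hne
      rw [if_neg fun h => hne (hi h)]
    · simp
  · rw [Function.extend_apply' _ _ _ hb]
    exact Finset.sum_eq_zero fun a _ => if_neg fun h => hb ⟨a, h⟩

theorem indFun_eq_sum_extend {A B : Type*} [Group A] [Group B] [Finite A] [Fintype B] {i : A →* B}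
    (hi : Function.Injective i) (χ : A → ℂ) (b : B) :
    indFun i χ b =
      (Nat.card A : ℂ)⁻¹ * ∑ x : B, Function.extend i χ 0 (x * b * x⁻¹) := by
  classical
  have := Fintype.ofFinite A
  rw [indFun_eq_sum]
  simp only [sum_ite_eq_extend hi]

section Lattice

variable {H : Type*} [Group H]

theorem extend_val_of_mem {K : Subgroup H} (χ : K → ℂ) {h : H} (hh : h ∈ K) :
    Function.extend Subtype.val χ 0 h = χ ⟨h, hh⟩ :=
  Subtype.val_injective.extend_apply χ 0 (⟨h, hh⟩ : K)

theorem extend_val_of_notMem {K : Subgroup H} (χ : K → ℂ) {h : H} (hh : h ∉ K) :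
    Function.extend Subtype.val χ 0 h = 0 :=
  Function.extend_apply' _ _ _ fun ⟨a, ha⟩ => hh (ha ▸ a.2)

namespace CompatibleLattice

variable (𝓛 : CompatibleLattice H)

/-- The superclass functions of `K ∈ 𝓛`, extended by zero to functions on `H`. -/
def superclassFunctions (K : Subgroup H) (hK : K ∈ 𝓛.lattice) : Submodule ℂ (H → ℂ) :=
  (blockFunctions (𝓛.theory K hK).superclasses).map
    (Function.ExtendByZero.linearMap ℂ (Subtype.val : K → H))

/-- The supercharacters of `K ∈ 𝓛`, extended by zero to functions on `H`. -/
def extendedSupercharacters (K : Subgroup H) (hK : K ∈ 𝓛.lattice) : Set (H → ℂ) :=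
  (fun χ => Function.extend Subtype.val χ 0) '' (𝓛.theory K hK).supercharacters

variable {𝓛} {K K₁ K₂ : Subgroup H}

theorem mem_superclassFunctions {hK : K ∈ 𝓛.lattice} {f : H → ℂ} :
    f ∈ 𝓛.superclassFunctions K hK ↔
      (∀ h ∉ K, f h = 0) ∧ (𝓛.theory K hK).IsSuperclassFunction fun x => f x := by
  constructor
  · rintro ⟨χ, hχ, rfl⟩
    refine ⟨fun h hh => extend_val_of_notMem χ hh, ?_⟩
    have : (fun x : K => Function.ExtendByZero.linearMap ℂ (Subtype.val : K → H) χ x) = χ :=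
      funext fun x => extend_val_of_mem χ x.2
    rw [this]
    exact hχ
  · rintro ⟨h0, hf⟩
    refine ⟨_, hf, funext fun h => ?_⟩
    by_cases hh : h ∈ K
    · exact extend_val_of_mem (fun x : K => f x) hh
    · exact (extend_val_of_notMem (fun x : K => f x) hh).trans (h0 h hh).symm

theorem span_extendedSupercharacters [Finite H] (hK : K ∈ 𝓛.lattice) :
    Submodule.span ℂ (𝓛.extendedSupercharacters K hK) = 𝓛.superclassFunctions K hK := by
  rw [superclassFunctions, ← (𝓛.theory K hK).span_supercharacters, Submodule.map_span]
  rfl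

theorem extendedSupercharacters_congr (h : K₁ = K₂) (h₁ : K₁ ∈ 𝓛.lattice) (h₂ : K₂ ∈ 𝓛.lattice) :
    𝓛.extendedSupercharacters K₁ h₁ = 𝓛.extendedSupercharacters K₂ h₂ := by
  subst h
  rfl

theorem superclassFunctions_congr (h : K₁ = K₂) (h₁ : K₁ ∈ 𝓛.lattice) (h₂ : K₂ ∈ 𝓛.lattice) :
    𝓛.superclassFunctions K₁ h₁ = 𝓛.superclassFunctions K₂ h₂ := by
  subst h
  rfl

theorem conj_mem_extendedSupercharacters {hK : K ∈ 𝓛.lattice} {f : H → ℂ}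
    (hf : f ∈ 𝓛.extendedSupercharacters K hK) (y : H) :
    (fun h => f (y * h * y⁻¹)) ∈
      𝓛.extendedSupercharacters (MulAut.conj y⁻¹ • K) (𝓛.conj_mem K hK y⁻¹) := by
  obtain ⟨χ, hχ, rfl⟩ := hf
  refine ⟨_, 𝓛.conjFun_mem K hK y⁻¹ χ hχ, funext fun h => ?_⟩
  have hiff : h ∈ MulAut.conj y⁻¹ • K ↔ y * h * y⁻¹ ∈ K := by
    rw [Subgroup.mem_pointwise_smul_iff_inv_smul_mem]
    simp [← map_inv, MulAut.smul_def]
  by_cases hh : h ∈ MulAut.conj y⁻¹ • K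
  · simp only [extend_val_of_mem _ hh, extend_val_of_mem _ (hiff.mp hh), conjFun, inv_inv]
  · simp only [extend_val_of_notMem _ hh, extend_val_of_notMem _ (mt hiff.mpr hh)]

theorem conj_mem_superclassFunctions [Finite H] {hK : K ∈ 𝓛.lattice} {f : H → ℂ}
    (hf : f ∈ 𝓛.superclassFunctions K hK) (y : H) :
    (fun h => f (y * h * y⁻¹)) ∈
      𝓛.superclassFunctions (MulAut.conj y⁻¹ • K) (𝓛.conj_mem K hK y⁻¹) := by
  rw [← span_extendedSupercharacters] at hf
  induction hf using Submodule.span_induction with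
  | mem f h =>
    rw [← span_extendedSupercharacters]
    exact Submodule.subset_span (conj_mem_extendedSupercharacters h y)
  | zero => exact Submodule.zero_mem _
  | add f f' _ _ h h' => exact Submodule.add_mem _ h h'
  | smul a f _ h => exact Submodule.smul_mem _ a h

theorem mul_mem_superclassFunctions {h₁ : K₁ ∈ 𝓛.lattice} {h₂ : K₂ ∈ 𝓛.lattice} {f f' : H → ℂ}
    (hf : f ∈ 𝓛.superclassFunctions K₁ h₁) (hf' : f' ∈ 𝓛.superclassFunctions K₂ h₂) :
    f * f' ∈ 𝓛.superclassFunctions (K₁ ⊓ K₂) (𝓛.lattice.inf_mem h₁ h₂) := by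
  rw [mem_superclassFunctions] at hf hf' ⊢
  constructor
  · intro h hh
    rw [Pi.mul_apply]
    by_cases h1 : h ∈ K₁
    · rw [hf'.1 h fun h2 => hh ⟨h1, h2⟩, mul_zero]
    · rw [hf.1 h h1, zero_mul]
  · intro L hL x hx y hy
    have e1 := 𝓛.res_mem _ K₁ (𝓛.lattice.inf_mem h₁ h₂) h₁ inf_le_left _ hf.2 L hL x hx y hy
    have e2 := 𝓛.res_mem _ K₂ (𝓛.lattice.inf_mem h₁ h₂) h₂ inf_le_right _ hf'.2 L hL x hx y hy
    exact congrArg₂ (· * ·) e1 e2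

theorem sum_conj_eq_extend_indFun [Finite H] (hle : K₁ ≤ K₂) [Fintype K₂] (χ : K₁ → ℂ) (h : H) :
    ∑ z : K₂, Function.extend Subtype.val χ 0 ((z : H) * h * (z : H)⁻¹) =
      Nat.card K₁ * Function.extend Subtype.val (indFun (Subgroup.inclusion hle) χ) 0 h := by
  by_cases hh : h ∈ K₂
  · have hc : (Nat.card K₁ : ℂ) ≠ 0 := Nat.cast_ne_zero.mpr Nat.card_pos.ne'
    rw [extend_val_of_mem _ hh, indFun_eq_sum_extend (Subgroup.inclusion_injective hle),
      mul_inv_cancel_left₀ hc]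
    refine Finset.sum_congr rfl fun z _ => ?_
    by_cases hz : (z : H) * h * (z : H)⁻¹ ∈ K₁
    · rw [extend_val_of_mem _ hz]
      exact ((Subgroup.inclusion_injective hle).extend_apply χ 0 ⟨_, hz⟩).symm
    · rw [extend_val_of_notMem _ hz, Function.extend_apply']
      · rfl
      · rintro ⟨a, ha⟩
        have : (a : H) = z * h * (z : H)⁻¹ := congrArg Subtype.val ha
        exact hz (this ▸ a.2)
  · rw [extend_val_of_notMem _ hh, mul_zero]
    refine Finset.sum_eq_zero fun z _ => extend_val_of_notMem _ fun hz => hh ?_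
    have := K₂.mul_mem (K₂.mul_mem (K₂.inv_mem z.2) (hle hz)) z.2
    simpa [mul_assoc] using this

theorem sum_conj_mem_superclassFunctions [Finite H] (hle : K₁ ≤ K₂) [Fintype K₂]
    {h₁ : K₁ ∈ 𝓛.lattice} (h₂ : K₂ ∈ 𝓛.lattice) {f : H → ℂ}
    (hf : f ∈ 𝓛.superclassFunctions K₁ h₁) :
    (fun h => ∑ z : K₂, f ((z : H) * h * (z : H)⁻¹)) ∈ 𝓛.superclassFunctions K₂ h₂ := by
  obtain ⟨χ, hχ, rfl⟩ := hf
  have := (𝓛.superclassFunctions K₂ h₂).smul_mem (Nat.card K₁ : ℂ)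
    (Submodule.mem_map_of_mem (f := Function.ExtendByZero.linearMap ℂ (Subtype.val : K₂ → H))
      (mem_blockFunctions.mpr (𝓛.ind_mem K₁ K₂ h₁ h₂ hle χ hχ)))
  convert this using 1
  exact funext fun h => sum_conj_eq_extend_indFun hle χ h

/-- The indicator of `1` is a superclass function of each `K ∈ 𝓛`: it is a multiple of a function
induced from the trivial subgroup. -/
theorem indicator_one_mem_superclassFunctions [Finite H] (hK : K ∈ 𝓛.lattice) :
    ({1} : Set H).indicator 1 ∈ 𝓛.superclassFunctions K hK := by
  classical
  have := Fintype.ofFinite K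
  have hbot : ({1} : Set H).indicator 1 ∈ 𝓛.superclassFunctions ⊥ 𝓛.bot_mem := by
    refine mem_superclassFunctions.mpr ⟨fun h hh => ?_, fun L _ x _ y _ => ?_⟩
    · exact Set.indicator_of_notMem (by simpa using hh) _
    · rw [Subsingleton.elim x y]
  have h1 := (𝓛.superclassFunctions K hK).smul_mem (Nat.card K : ℂ)⁻¹
    (sum_conj_mem_superclassFunctions bot_le hK hbot)
  convert h1 using 1
  funext h
  have : ∀ z : K, ({1} : Set H).indicator (1 : H → ℂ) ((z : H) * h * (z : H)⁻¹) =
      ({1} : Set H).indicator 1 h := fun z => by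
    simp only [Set.indicator_apply, Set.mem_singleton_iff, conj_eq_one_iff]
    rfl
  have hc : (Nat.card K : ℂ) ≠ 0 := Nat.cast_ne_zero.mpr Nat.card_pos.ne'
  simp only [Pi.smul_apply, this, Finset.sum_const, Finset.card_univ, nsmul_eq_mul, smul_eq_mul,
    Fintype.card_eq_nat_card, inv_mul_cancel_left₀ hc]

theorem eq_smul_indicator_of_mem_superclassFunctions_bot {hK : ⊥ ∈ 𝓛.lattice} {f : H → ℂ}
    (hf : f ∈ 𝓛.superclassFunctions ⊥ hK) : f = f 1 • ({1} : Set H).indicator 1 := by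
  funext h
  by_cases hh : h = 1
  · subst hh
    simp
  · rw [Pi.smul_apply, Set.indicator_of_notMem (by simpa using hh), smul_zero]
    exact (mem_superclassFunctions.mp hf).1 h (by simpa using hh)

theorem sum_mul_star_eq_zero [Fintype H] {hK : K ∈ 𝓛.lattice} {f f' : H → ℂ}
    (hf : f ∈ 𝓛.extendedSupercharacters K hK) (hf' : f' ∈ 𝓛.extendedSupercharacters K hK)
    (hne : f ≠ f') : ∑ h : H, f h * star (f' h) = 0 := by
  obtain ⟨χ, hχ, rfl⟩ := hf
  obtain ⟨χ', hχ', rfl⟩ := hf'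
  have := Fintype.ofFinite K
  have h0 := (𝓛.theory K hK).charInner_eq_zero hχ hχ' fun h => hne (by rw [h])
  rw [charInner_eq_sum, mul_eq_zero] at h0
  rw [← h0.resolve_left (inv_ne_zero (Nat.cast_ne_zero.mpr Nat.card_pos.ne'))]
  refine (Fintype.sum_of_injective Subtype.val Subtype.val_injective _ _ (fun h hh => ?_)
    fun k => ?_).symm
  · have hh' : h ∉ K := by simpa using hh
    simp only [extend_val_of_notMem _ hh', zero_mul]
  · simp only [extend_val_of_mem _ k.2]

end CompatibleLattice

end Lattice

/-! ### Linear characters of a finite abelian group -/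

section LinearCharacters

variable {N : Type*} [CommGroup N]

instance [Finite N] : Finite (N →* ℂˣ) :=
  Finite.of_equiv _ (CommGroup.monoidHom_mulEquiv_of_hasEnoughRootsOfUnity N ℂ).some.symm.toEquiv

theorem star_coe_linearCharacter [Finite N] (ψ : N →* ℂˣ) (n : N) :
    star (ψ n : ℂ) = ((ψ⁻¹ n : ℂˣ) : ℂ) := by
  have h1 : (ψ n : ℂ) ^ Nat.card N = 1 := by
    rw [← Units.val_pow_eq_pow_val, ← map_pow, pow_card_eq_one', map_one, Units.val_one]
  have h2 : ‖(ψ n : ℂ)‖ = 1 := Complex.norm_eq_one_of_pow_eq_one h1 Nat.card_pos.ne'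
  rw [MonoidHom.inv_apply, Units.val_inv_eq_inv_val, Complex.inv_eq_conj h2]
  rfl

theorem sum_linearCharacter_eq_zero [Fintype N] {ψ : N →* ℂˣ} (hψ : ψ ≠ 1) :
    ∑ n : N, (ψ n : ℂ) = 0 := by
  refine sum_hom_units_eq_zero ((Units.coeHom ℂ).comp ψ) fun h => hψ ?_
  ext n
  simpa using DFunLike.congr_fun h n

theorem sum_mul_star_linearCharacter [Fintype N] {ψ ψ' : N →* ℂˣ} (h : ψ ≠ ψ') :
    ∑ n : N, (ψ n : ℂ) * star (ψ' n : ℂ) = 0 := by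
  rw [← sum_linearCharacter_eq_zero (ψ := ψ * ψ'⁻¹) 
    fun h' => h (mul_inv_eq_one.mp h')]
  exact Finset.sum_congr rfl fun n _ => by
    rw [star_coe_linearCharacter, MonoidHom.mul_apply, Units.val_mul]

theorem sum_linearCharacters_apply_eq_zero [Finite N] [Fintype (N →* ℂˣ)] {n : N} (hn : n ≠ 1) :
    ∑ ψ : N →* ℂˣ, (ψ n : ℂ) = 0 := by
  refine sum_hom_units_eq_zero ((Units.coeHom ℂ).comp (MonoidHom.eval n)) fun h => ?_
  obtain ⟨ψ, hψ⟩ := CommGroup.exists_apply_ne_one_of_hasEnoughRootsOfUnity N ℂ hn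
  refine hψ (Units.ext ?_)
  simpa using DFunLike.congr_fun h ψ

end LinearCharacters

/-! ### Sums over `H` of conjugates of a product function on `N ⋊ H` -/

section ConjSum

variable {N H : Type*} [CommGroup N] [Group H] (φ : H →* MulAut N)

@[simp]
theorem conjLin_apply (h : H) (ψ : N →* ℂˣ) (n : N) : conjLin φ h ψ n = ψ (φ h n) := rfl

theorem conjLin_conjLin (x y : H) (ψ : N →* ℂˣ) :
    conjLin φ x (conjLin φ y ψ) = conjLin φ (y * x) ψ := by
  ext n
  simp

@[simp]
theorem conjLin_one (ψ : N →* ℂˣ) : conjLin φ 1 ψ = ψ := by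
  ext n
  simp

@[simp]
theorem conjLin_trivial (x : H) : conjLin φ x 1 = 1 := by
  ext n
  simp

theorem mem_inertia {ψ : N →* ℂˣ} {h : H} : h ∈ inertia φ ψ ↔ conjLin φ h ψ = ψ := Iff.rfl

instance [Finite N] [Finite H] : Finite (N ⋊[φ] H) :=
  Finite.of_equiv _ SemidirectProduct.equivProd.symm

variable [Fintype H]

/-- The sum over `y : H` of the conjugates by `y` of the function `n h ↦ ψ n * f h`. For `f` the
extension by zero of a supercharacter of `H_ψ`, it is a multiple of a member of `SCh(𝓛)`. -/
def conjSum (ψ : N →* ℂˣ) (f : H → ℂ) : N ⋊[φ] H → ℂ :=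
  fun g => ∑ y : H, (ψ (φ y g.left) : ℂ) * f (y * g.right * y⁻¹)

variable {φ}

theorem conjSum_add (ψ : N →* ℂˣ) (f f' : H → ℂ) :
    conjSum φ ψ (f + f') = conjSum φ ψ f + conjSum φ ψ f' := by
  funext g
  simp only [conjSum, Pi.add_apply, mul_add, Finset.sum_add_distrib]

theorem conjSum_smul (ψ : N →* ℂˣ) (a : ℂ) (f : H → ℂ) :
    conjSum φ ψ (a • f) = a • conjSum φ ψ f := by
  funext g
  simp only [conjSum, Pi.smul_apply, smul_eq_mul, Finset.mul_sum, mul_left_comm]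

theorem conjSum_sum {ι : Type*} (s : Finset ι) (ψ : N →* ℂˣ) (F : ι → H → ℂ) :
    conjSum φ ψ (fun h => ∑ j ∈ s, F j h) = ∑ j ∈ s, conjSum φ ψ (F j) := by
  funext g
  simp only [conjSum, Finset.sum_apply, Finset.mul_sum]
  exact Finset.sum_comm

/-- Conjugating both arguments does not change the sum of the conjugates. -/
theorem conjSum_conj (ψ : N →* ℂˣ) (f : H → ℂ) (y : H) :
    conjSum φ (conjLin φ y ψ) (fun h => f (y * h * y⁻¹)) = conjSum φ ψ f := by
  funext g
  refine Fintype.sum_equiv (Equiv.mulLeft y) _ _ fun x => ?_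
  simp [mul_assoc]

theorem conjSum_conj_of_mem_inertia {ψ : N →* ℂˣ} (f : H → ℂ) {y : H} (hy : y ∈ inertia φ ψ) :
    conjSum φ ψ (fun h => f (y * h * y⁻¹)) = conjSum φ ψ f := by
  conv_lhs => rw [← (mem_inertia φ).mp hy]
  exact conjSum_conj ψ f y

theorem conjSum_mul (ψ ψ' : N →* ℂˣ) (f f' : H → ℂ) :
    conjSum φ ψ f * conjSum φ ψ' f' =
      ∑ u : H, conjSum φ (ψ * conjLin φ u ψ') (f * fun h => f' (u * h * u⁻¹)) := by
  funext g
  simp only [conjSum, Pi.mul_apply, Finset.sum_apply, Finset.sum_mul_sum]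
  rw [Finset.sum_comm (s := (Finset.univ : Finset H)) (t := Finset.univ)
    (f := fun u y => ((ψ * conjLin φ u ψ') (φ y g.left) : ℂ) * _)]
  refine Finset.sum_congr rfl fun y _ => ?_
  refine (Fintype.sum_equiv (Equiv.mulRight y) _ _ fun u => ?_).symm
  simp only [MonoidHom.mul_apply, Units.val_mul, conjLin_apply, Equiv.coe_mulRight, map_mul,
    MulAut.mul_apply, mul_inv_rev, mul_assoc]
  ring

/-- By orthogonality of the linear characters of `N`, only pairs of conjugates with the same
`N`-part contribute to the inner product. -/
theorem charInner_conjSum_eq_zero [Finite N] {ψ ψ' : N →* ℂˣ} {f f' : H → ℂ}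
    (hyp : ∀ y y' : H, conjLin φ y ψ = conjLin φ y' ψ' →
      ∑ h : H, f (y * h * y⁻¹) * star (f' (y' * h * y'⁻¹)) = 0) :
    charInner (conjSum φ ψ f) (conjSum φ ψ' f') = 0 := by
  have := Fintype.ofFinite N
  have := Fintype.ofFinite (N ⋊[φ] H)
  rw [charInner_eq_sum]
  have key : ∑ g : N ⋊[φ] H, conjSum φ ψ f g * star (conjSum φ ψ' f' g) =
      ∑ y : H, ∑ y' : H, (∑ n : N, (conjLin φ y ψ n : ℂ) * star (conjLin φ y' ψ' n : ℂ)) *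
        ∑ h : H, f (y * h * y⁻¹) * star (f' (y' * h * y'⁻¹)) := by
    rw [Fintype.sum_equiv SemidirectProduct.equivProd _
      (fun p : N × H => ∑ y : H, ∑ y' : H, ((ψ (φ y p.1) : ℂ) * f (y * p.2 * y⁻¹)) *
        star ((ψ' (φ y' p.1) : ℂ) * f' (y' * p.2 * y'⁻¹))) fun g => ?_]
    · rw [Finset.sum_comm]
      refine Finset.sum_congr rfl fun y _ => ?_
      rw [Finset.sum_comm]
      refine Finset.sum_congr rfl fun y' _ => ?_
      rw [Fintype.sum_prod_type, Finset.sum_mul_sum]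
      refine Finset.sum_congr rfl fun n _ => Finset.sum_congr rfl fun h _ => ?_
      simp only [conjLin_apply, star_mul']
      ring
    · simp only [conjSum, star_sum, Finset.sum_mul_sum]
      rfl
  rw [key, Finset.sum_eq_zero, mul_zero]
  intro y _
  refine Finset.sum_eq_zero fun y' _ => ?_
  by_cases h : conjLin φ y ψ = conjLin φ y' ψ'
  · rw [hyp y y' h, mul_zero]
  · rw [sum_mul_star_linearCharacter h, zero_mul]

open Classical in
/-- Fourier inversion on `N`, summed over the conjugates by `H`. -/
theorem sum_smul_conjSum_indicator [Finite N] [Fintype (N →* ℂˣ)] (n₀ : N) :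
    ∑ ψ : N →* ℂˣ, (ψ n₀⁻¹ : ℂ) • conjSum φ ψ (({1} : Set H).indicator 1) =
      fun g => if g.right = 1 then
        (Fintype.card (N →* ℂˣ) : ℂ) * (Finset.univ.filter fun y : H => φ y g.left = n₀).card
        else 0 := by
  funext g
  have hind : ∀ y : H, ({1} : Set H).indicator (1 : H → ℂ) (y * g.right * y⁻¹) =
      if g.right = 1 then 1 else 0 := fun y => by
    simp only [Set.indicator_apply, Set.mem_singleton_iff, conj_eq_one_iff]
    rfl
  simp only [Finset.sum_apply, Pi.smul_apply, smul_eq_mul, conjSum, hind]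
  split_ifs with hg
  · simp only [mul_one, Finset.mul_sum]
    rw [Finset.sum_comm, Finset.card_filter, Nat.cast_sum, Finset.mul_sum]
    refine Finset.sum_congr rfl fun y _ => ?_
    by_cases hy : φ y g.left = n₀
    · rw [if_pos hy, hy, Nat.cast_one, mul_one]
      simp
    · rw [if_neg hy, Nat.cast_zero, mul_zero]
      rw [← sum_linearCharacters_apply_eq_zero (n := n₀⁻¹ * φ y g.left)
        (fun h => hy (inv_mul_eq_one.mp h).symm)]
      exact Finset.sum_congr rfl fun ψ _ => by rw [map_mul, Units.val_mul]
  · simp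

/-- `ψ ⋊ χ` as a sum of conjugates: the factor `ψ` is invariant under `K ≤ I_H(ψ)`, so the sum over
`N` that occurs in the induction is constant. -/
theorem psiRtimes_eq_conjSum [Finite N] {ψ : N →* ℂˣ} {K : Subgroup H} (hK : K ≤ inertia φ ψ)
    (χ : K → ℂ) :
    psiRtimes φ ψ K χ =
      (Nat.card K : ℂ)⁻¹ • conjSum φ ψ (Function.extend Subtype.val χ 0) := by
  have := Fintype.ofFinite N
  have := Fintype.ofFinite (N ⋊[φ] H)
  funext g
  set P : Subgroup (N ⋊[φ] H) := K.comap SemidirectProduct.rightHom with hP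
  rw [psiRtimes, indFun_eq_sum_extend (Subgroup.subtype_injective P)]
  have hterm : ∀ x : N ⋊[φ] H, Function.extend P.subtype
      (fun g : P => (ψ g.1.left : ℂ) * χ ⟨g.1.right, g.2⟩) 0 (x * g * x⁻¹) =
      (ψ (φ x.right g.left) : ℂ) *
        Function.extend Subtype.val χ 0 (x.right * g.right * x.right⁻¹) := by
    intro x
    have hright : (x * g * x⁻¹).right = x.right * g.right * x.right⁻¹ := by simp
    by_cases hx : x.right * g.right * x.right⁻¹ ∈ K
    · have hxP : x * g * x⁻¹ ∈ P := by
        rw [hP, Subgroup.mem_comap, SemidirectProduct.rightHom_eq_right, hright]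
        exact hx
      have h1 := (Subgroup.subtype_injective P).extend_apply
        (fun g : P => (ψ g.1.left : ℂ) * χ ⟨g.1.right, g.2⟩) 0 ⟨_, hxP⟩
      rw [Subgroup.subtype_apply] at h1
      rw [h1, extend_val_of_mem _ hx]
      have hψ : ∀ n, ψ (φ (x.right * g.right * x.right⁻¹) n) = ψ n := fun n =>
        DFunLike.congr_fun ((mem_inertia φ).mp (hK hx)) n
      have hleft : ψ (x * g * x⁻¹).left = ψ (φ x.right g.left) := by
        have h2 : (x * g * x⁻¹).left =
            x.left * φ x.right g.left * φ (x.right * g.right * x.right⁻¹) x.left⁻¹ := by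
          simp
        rw [h2, map_mul, map_mul, hψ, map_inv, mul_comm (ψ x.left), mul_inv_cancel_right]
      rw [hleft]
      congr 2
    · have hxP : ¬ ∃ a : P, P.subtype a = x * g * x⁻¹ := by
        rintro ⟨a, ha⟩
        have h2 : x * g * x⁻¹ ∈ P := ha ▸ a.2
        rw [hP, Subgroup.mem_comap, SemidirectProduct.rightHom_eq_right, hright] at h2
        exact hx h2
      rw [Function.extend_apply' _ _ _ hxP, extend_val_of_notMem _ hx, mul_zero]
      rfl
  have hcard : Nat.card P = Nat.card N * Nat.card K := by
    rw [← Nat.card_prod]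
    exact Nat.card_congr
      { toFun := fun g => (g.1.left, ⟨g.1.right, g.2⟩)
        invFun := fun p => ⟨⟨p.1, p.2.1⟩, p.2.2⟩
        left_inv := fun _ => rfl
        right_inv := fun _ => rfl }
  have hN : (Nat.card N : ℂ) ≠ 0 := Nat.cast_ne_zero.mpr Nat.card_pos.ne'
  refine (congrArg ((Nat.card P : ℂ)⁻¹ * ·) (Finset.sum_congr rfl fun x _ => hterm x)).trans ?_
  have hsum : ∑ x : N ⋊[φ] H, (ψ (φ x.right g.left) : ℂ) *
      Function.extend Subtype.val χ 0 (x.right * g.right * x.right⁻¹) =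
      Nat.card N * conjSum φ ψ (Function.extend Subtype.val χ 0) g := by
    refine (Fintype.sum_equiv SemidirectProduct.equivProd _
      (fun p : N × H => (ψ (φ p.2 g.left) : ℂ) *
        Function.extend Subtype.val χ 0 (p.2 * g.right * p.2⁻¹)) fun _ => rfl).trans ?_
    rw [Fintype.sum_prod_type]
    dsimp only
    rw [Finset.sum_const, Finset.card_univ, nsmul_eq_mul, conjSum,
      Fintype.card_eq_nat_card]
  rw [hsum, hcard, Nat.cast_mul, mul_inv, Pi.smul_apply, smul_eq_mul]
  field_simp

/-- `ψ ⋊ Ind χ` is the sum of conjugates given by `χ` itself: `I_H(ψ)` fixes `ψ`, so averaging `χ`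
over `I_H(ψ)` changes nothing. -/
theorem psiRtimes_indFun [Finite N] {ψ : N →* ℂˣ} {K : Subgroup H} (hK : K ≤ inertia φ ψ)
    (χ : K → ℂ) :
    psiRtimes φ ψ (inertia φ ψ) (indFun (Subgroup.inclusion hK) χ) =
      (Nat.card K : ℂ)⁻¹ • conjSum φ ψ (Function.extend Subtype.val χ 0) := by
  have := Fintype.ofFinite (inertia φ ψ)
  have hK0 : (Nat.card K : ℂ) ≠ 0 := Nat.cast_ne_zero.mpr Nat.card_pos.ne'
  have hI0 : (Nat.card (inertia φ ψ) : ℂ) ≠ 0 := Nat.cast_ne_zero.mpr Nat.card_pos.ne'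
  rw [psiRtimes_eq_conjSum le_rfl]
  have h1 : Function.extend Subtype.val (indFun (Subgroup.inclusion hK) χ) 0 =
      (Nat.card K : ℂ)⁻¹ • fun h => ∑ z : inertia φ ψ,
        Function.extend Subtype.val χ 0 ((z : H) * h * (z : H)⁻¹) := by
    funext h
    rw [Pi.smul_apply, smul_eq_mul, CompatibleLattice.sum_conj_eq_extend_indFun hK,
      inv_mul_cancel_left₀ hK0]
  rw [h1, conjSum_smul, conjSum_sum]
  simp only [conjSum_conj_of_mem_inertia _ (SetLike.coe_mem _), Finset.sum_const, Finset.card_univ,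
    Fintype.card_eq_nat_card, ← Nat.cast_smul_eq_nsmul ℂ]
  rw [smul_comm, inv_smul_smul₀ hI0]

end ConjSum

/-! ### The span of `SCh(𝓛)` -/

section SChSpan

open CompatibleLattice

variable {N H : Type*} [CommGroup N] [Group H] {φ : H →* MulAut N} {𝓛 : CompatibleLattice H}
  (c : LittleGroupChoice φ 𝓛)

/-- `n k ↦ ψ n * χ k` is the product of a linear character of `N K` and an inflated character, as
`K` fixes `ψ`. -/
theorem isCharacter_psiRtimes [Finite N] [Finite H] {ψ : N →* ℂˣ} {K : Subgroup H}
    (hK : K ≤ inertia φ ψ) {χ : K → ℂ} (hχ : IsCharacter χ) :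
    IsCharacter (psiRtimes φ ψ K χ) := by
  set P : Subgroup (N ⋊[φ] H) := K.comap SemidirectProduct.rightHom
  let μ : P →* ℂˣ :=
    { toFun := fun g => ψ g.1.left
      map_one' := by simp
      map_mul' := fun x y => by
        have h : ψ (φ x.1.right y.1.left) = ψ y.1.left :=
          DFunLike.congr_fun ((mem_inertia φ).mp (hK x.2)) _
        simp [h] }
  let p : P →* K := (SemidirectProduct.rightHom.comp P.subtype).codRestrict K fun g => g.2
  exact ((hχ.comp p).linear_mul μ).indFun (Subgroup.subtype_injective P)

theorem isCharacter_of_mem_SCh [Finite N] [Finite H] {S : Set (N →* ℂˣ)} {ζ : N ⋊[φ] H → ℂ}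
    (hζ : ζ ∈ SCh c S) : IsCharacter ζ := by
  obtain ⟨ψ, _, _, ⟨χ, hχ, rfl⟩, rfl⟩ := hζ
  exact isCharacter_psiRtimes le_rfl
    (((𝓛.theory _ _).isCharacter χ hχ).indFun (Subgroup.inclusion_injective _))

variable {c} in
theorem LittleGroupChoice.conj_mem_extendedSupercharacters {ψ : N →* ℂˣ} {f : H → ℂ}
    (hf : f ∈ 𝓛.extendedSupercharacters (c.grp ψ) (c.mem ψ)) (y : H) :
    (fun h => f (y * h * y⁻¹)) ∈
      𝓛.extendedSupercharacters (c.grp (conjLin φ y ψ)) (c.mem (conjLin φ y ψ)) := by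
  rw [extendedSupercharacters_congr (c.conj ψ y) _ (𝓛.conj_mem _ (c.mem ψ) y⁻¹)]
  exact CompatibleLattice.conj_mem_extendedSupercharacters hf y

variable [Fintype H]

theorem mem_SCh_iff [Finite N] {S : Set (N →* ℂˣ)} {ζ : N ⋊[φ] H → ℂ} :
    ζ ∈ SCh c S ↔ ∃ ψ ∈ S, ∃ f ∈ 𝓛.extendedSupercharacters (c.grp ψ) (c.mem ψ),
      ζ = (Nat.card (c.grp ψ) : ℂ)⁻¹ • conjSum φ ψ f := by
  constructor
  · rintro ⟨ψ, hψ, _, ⟨χ, hχ, rfl⟩, rfl⟩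
    exact ⟨ψ, hψ, _, ⟨χ, hχ, rfl⟩, psiRtimes_indFun (c.le_inertia ψ) χ⟩
  · rintro ⟨ψ, hψ, _, ⟨χ, hχ, rfl⟩, rfl⟩
    exact ⟨ψ, hψ, _, ⟨χ, hχ, rfl⟩, (psiRtimes_indFun (c.le_inertia ψ) χ).symm⟩

namespace LittleGroupChoice

/-- The space spanned by the sums of conjugates of `n h ↦ ψ n * f h`, where `ψ` is any irreducible
character of `N` and `f` is a superclass function of `H_ψ`, extended by zero. -/
def superclassSpace : Submodule ℂ (N ⋊[φ] H → ℂ) :=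
  Submodule.span ℂ {F | ∃ ψ, ∃ f ∈ 𝓛.superclassFunctions (c.grp ψ) (c.mem ψ), F = conjSum φ ψ f}

variable {c}

theorem conjSum_mem_superclassSpace {ψ : N →* ℂˣ} {f : H → ℂ}
    (hf : f ∈ 𝓛.superclassFunctions (c.grp ψ) (c.mem ψ)) :
    conjSum φ ψ f ∈ c.superclassSpace :=
  Submodule.subset_span ⟨ψ, f, hf, rfl⟩

theorem conj_mem_superclassFunctions {ψ : N →* ℂˣ} {f : H → ℂ}
    (hf : f ∈ 𝓛.superclassFunctions (c.grp ψ) (c.mem ψ)) (y : H) :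
    (fun h => f (y * h * y⁻¹)) ∈
      𝓛.superclassFunctions (c.grp (conjLin φ y ψ)) (c.mem (conjLin φ y ψ)) := by
  rw [superclassFunctions_congr (c.conj ψ y) _ (𝓛.conj_mem _ (c.mem ψ) y⁻¹)]
  exact CompatibleLattice.conj_mem_superclassFunctions hf y

/-- A superclass function of a smaller member of the lattice may be replaced by a multiple of the
function that it induces on `H_ψ`. -/
theorem conjSum_mem_superclassSpace_of_le {ψ : N →* ℂˣ} {K : Subgroup H} {hK : K ∈ 𝓛.lattice}
    (hle : K ≤ c.grp ψ) {f : H → ℂ} (hf : f ∈ 𝓛.superclassFunctions K hK) :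
    conjSum φ ψ f ∈ c.superclassSpace := by
  have := Fintype.ofFinite (c.grp ψ)
  have h1 := conjSum_mem_superclassSpace (sum_conj_mem_superclassFunctions hle (c.mem ψ) hf)
  rw [conjSum_sum] at h1
  have h2 : ∀ z : c.grp ψ, conjSum φ ψ (fun h => f ((z : H) * h * (z : H)⁻¹)) = conjSum φ ψ f :=
    fun z => conjSum_conj_of_mem_inertia f (c.le_inertia ψ z.2)
  simp only [h2, Finset.sum_const, Finset.card_univ, Fintype.card_eq_nat_card,
    ← Nat.cast_smul_eq_nsmul ℂ] at h1
  exact (Submodule.smul_mem_iff _ (Nat.cast_ne_zero.mpr Nat.card_pos.ne')).mp h1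

theorem conjSum_indicator_mem_superclassSpace (ψ : N →* ℂˣ) :
    conjSum φ ψ (({1} : Set H).indicator 1) ∈ c.superclassSpace :=
  conjSum_mem_superclassSpace (indicator_one_mem_superclassFunctions (c.mem ψ))

/-- Closure under products. This is where `H_ψ ∩ H_ψ' ≤ H_{ψ ψ'}` enters. -/
theorem mul_mem_superclassSpace {F F' : N ⋊[φ] H → ℂ} (hF : F ∈ c.superclassSpace)
    (hF' : F' ∈ c.superclassSpace) : F * F' ∈ c.superclassSpace := by
  induction hF using Submodule.span_induction with
  | mem F h =>
    obtain ⟨ψ, f, hf, rfl⟩ := h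
    induction hF' using Submodule.span_induction with
    | mem F' h' =>
      obtain ⟨ψ', f', hf', rfl⟩ := h'
      rw [conjSum_mul]
      exact Submodule.sum_mem _ fun u _ => conjSum_mem_superclassSpace_of_le
        (c.inf_le ψ (conjLin φ u ψ'))
        (mul_mem_superclassFunctions hf (conj_mem_superclassFunctions hf' u))
    | zero => rw [mul_zero]; exact Submodule.zero_mem _
    | add x y _ _ hx hy => rw [mul_add]; exact Submodule.add_mem _ hx hy
    | smul a x _ hx => rw [mul_smul_comm]; exact Submodule.smul_mem _ a hx
  | zero => rw [zero_mul]; exact Submodule.zero_mem _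
  | add x y _ _ hx hy => rw [add_mul]; exact Submodule.add_mem _ hx hy
  | smul a x _ hx => rw [smul_mul_assoc]; exact Submodule.smul_mem _ a hx

/-- The inflation of a superclass function `f` of `H = H_1` is a multiple of `conjSum φ 1 f`. -/
theorem inflation_mem_superclassSpace {f : H → ℂ}
    (hf : f ∈ 𝓛.superclassFunctions ⊤ 𝓛.top_mem) (hconj : ∀ y h, f (y * h * y⁻¹) = f h) :
    (fun g : N ⋊[φ] H => f g.right) ∈ c.superclassSpace := by
  rw [← superclassFunctions_congr c.one (c.mem 1)] at hf
  have h1 := c.superclassSpace.smul_mem (Nat.card H : ℂ)⁻¹ (conjSum_mem_superclassSpace hf)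
  convert h1 using 1
  funext g
  have hc : (Nat.card H : ℂ) ≠ 0 := Nat.cast_ne_zero.mpr Nat.card_pos.ne'
  simp [conjSum, hconj]

theorem one_mem_superclassSpace : (1 : N ⋊[φ] H → ℂ) ∈ c.superclassSpace := by
  refine inflation_mem_superclassSpace (f := 1) (mem_superclassFunctions.mpr ⟨?_, ?_⟩)
    fun _ _ => rfl
  · exact fun h hh => absurd (Subgroup.mem_top h) hh
  · exact fun _ _ _ _ _ _ => rfl

/-- By Fourier inversion, a function on `N` that is constant on the orbits of `H`, extended by zero
to `N ⋊ H`, is a combination of the functions `conjSum φ ψ δ` with `δ` the indicator of `1`. -/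
theorem extendOrbitFunction_mem_superclassSpace [Finite N] {F : N → ℂ}
    (hF : ∀ (y : H) (n : N), F (φ y n) = F n) :
    (fun g : N ⋊[φ] H => F g.left * ({1} : Set H).indicator 1 g.right) ∈ c.superclassSpace := by
  classical
  have := Fintype.ofFinite N
  have := Fintype.ofFinite (N →* ℂˣ)
  have h1 : ∑ n₀ : N, F n₀ • ∑ ψ : N →* ℂˣ, (ψ n₀⁻¹ : ℂ) •
      conjSum φ ψ (({1} : Set H).indicator 1) ∈ c.superclassSpace :=
    Submodule.sum_mem _ fun n₀ _ => Submodule.smul_mem _ _ <| Submodule.sum_mem _ fun ψ _ =>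
      Submodule.smul_mem _ _ (conjSum_indicator_mem_superclassSpace ψ)
  have h2 := c.superclassSpace.smul_mem
    ((Fintype.card (N →* ℂˣ) : ℂ) * Fintype.card H)⁻¹ h1
  convert h2 using 1
  funext g
  simp only [sum_smul_conjSum_indicator, Pi.smul_apply, Finset.sum_apply, smul_eq_mul]
  by_cases hg : g.right = 1
  · simp only [hg, if_true, Finset.card_filter, Nat.cast_sum, Finset.mul_sum]
    rw [Finset.sum_comm]
    have h3 : ∀ y : H, ∑ n₀ : N, ((Fintype.card (N →* ℂˣ) : ℂ) * Fintype.card H)⁻¹ *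
        (F n₀ * ((Fintype.card (N →* ℂˣ) : ℂ) * ((if φ y g.left = n₀ then 1 else 0 : ℕ) : ℂ))) =
        (Fintype.card H : ℂ)⁻¹ * F g.left := by
      intro y
      have hc : (Fintype.card (N →* ℂˣ) : ℂ) ≠ 0 := Nat.cast_ne_zero.mpr Fintype.card_ne_zero
      rw [Finset.sum_eq_single (φ y g.left)]
      · rw [if_pos rfl, hF, Nat.cast_one]
        field_simp
      · intro n₀ _ hne
        rw [if_neg hne.symm]
        simp
      · simp
    simp only [h3, Finset.sum_const, Finset.card_univ]
    simp
  · simp only [hg, if_false, mul_zero, Finset.sum_const_zero]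
    rw [Set.indicator_of_notMem (by simpa using hg), mul_zero]

theorem indicator_one_mem_superclassSpace [Finite N] :
    ({1} : Set (N ⋊[φ] H)).indicator 1 ∈ c.superclassSpace := by
  classical
  have h1 := extendOrbitFunction_mem_superclassSpace (c := c)
    (F := ({1} : Set N).indicator 1) fun y n => by
      simp only [Set.indicator_apply, Set.mem_singleton_iff, map_eq_one_iff _ (φ y).injective]
      rfl
  convert h1 using 1
  funext g
  have : g = 1 ↔ g.left = 1 ∧ g.right = 1 := SemidirectProduct.ext_iff
  simp only [Set.indicator_apply, Set.mem_singleton_iff, this, Pi.one_apply]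
  split_ifs <;> simp_all

/-- Every `ψ` is conjugate to a member of `S`, and `conjSum` does not change when both its arguments
are conjugated. -/
theorem superclassSpace_eq_span_SCh [Finite N] {S : Set (N →* ℂˣ)} (hS : IsOrbitReps φ S) :
    Submodule.span ℂ (SCh c S) = c.superclassSpace := by
  refine le_antisymm (Submodule.span_le.mpr fun ζ hζ => ?_) (Submodule.span_le.mpr ?_)
  · obtain ⟨ψ, _, f, hf, rfl⟩ := (mem_SCh_iff c).mp hζ
    refine Submodule.smul_mem _ _ (conjSum_mem_superclassSpace ?_)
    rw [← span_extendedSupercharacters]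
    exact Submodule.subset_span hf
  · rintro _ ⟨ψ, f, hf, rfl⟩
    obtain ⟨s, ⟨hs, y, rfl⟩, _⟩ := hS ψ
    rw [← conjSum_conj ψ f y]
    have hf' := conj_mem_superclassFunctions hf y
    generalize (fun h => f (y * h * y⁻¹)) = f' at hf'
    rw [← span_extendedSupercharacters] at hf'
    induction hf' using Submodule.span_induction with
    | mem f' h =>
      have hc : (Nat.card (c.grp (conjLin φ y ψ)) : ℂ) ≠ 0 :=
        Nat.cast_ne_zero.mpr Nat.card_pos.ne'
      exact (Submodule.smul_mem_iff _ (inv_ne_zero hc)).mp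
        (Submodule.subset_span ((mem_SCh_iff c).mpr ⟨_, hs, f', h, rfl⟩))
    | zero =>
      have : conjSum φ (conjLin φ y ψ) (0 : H → ℂ) = 0 := by
        simpa using conjSum_smul (φ := φ) (conjLin φ y ψ) 0 (0 : H → ℂ)
      rw [this]
      exact Submodule.zero_mem _
    | add f₁ f₂ _ _ h₁ h₂ => rw [conjSum_add]; exact Submodule.add_mem _ h₁ h₂
    | smul a f₁ _ h₁ => rw [conjSum_smul]; exact Submodule.smul_mem _ a h₁

/-- Sums of conjugates for the same `ψ` are equal or orthogonal: the inner product is a sum of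
inner products of one supercharacter of `H_ψ` with conjugates of the other under `I_H(ψ)`, which
are supercharacters of `H_ψ` again. -/
theorem charInner_conjSum_of_ne [Finite N] {ψ : N →* ℂˣ} {f f' : H → ℂ}
    (hf : f ∈ 𝓛.extendedSupercharacters (c.grp ψ) (c.mem ψ))
    (hf' : f' ∈ 𝓛.extendedSupercharacters (c.grp ψ) (c.mem ψ))
    (hne : conjSum φ ψ f ≠ conjSum φ ψ f') :
    charInner (conjSum φ ψ f) (conjSum φ ψ f') = 0 := by
  refine charInner_conjSum_eq_zero fun y y' hyy => ?_
  -- `f'` conjugated by `y' y⁻¹ ∈ I_H(ψ)` is again a supercharacter of `H_ψ`, and it gives the same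
  -- sum of conjugates as `f'`, so it differs from `f`.
  have hz : y' * y⁻¹ ∈ inertia φ ψ := by
    rw [mem_inertia, ← conjLin_conjLin, ← hyy, conjLin_conjLin, mul_inv_cancel, conjLin_one]
  have h1 := conj_mem_extendedSupercharacters hf' (y' * y⁻¹)
  rw [extendedSupercharacters_congr (congrArg c.grp ((mem_inertia φ).mp hz)) _ (c.mem ψ)] at h1
  have h2 := sum_mul_star_eq_zero hf h1 fun h => hne <| by
    rw [h, conjSum_conj_of_mem_inertia f' hz]
  rw [← h2]
  refine Fintype.sum_equiv (MulAut.conj y).toEquiv _ _ fun h => ?_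
  simp [mul_assoc]

theorem charInner_conjSum_of_not_conj [Finite N] {ψ ψ' : N →* ℂˣ}
    (hne : ∀ y : H, ψ' ≠ conjLin φ y ψ) (f f' : H → ℂ) :
    charInner (conjSum φ ψ f) (conjSum φ ψ' f') = 0 :=
  charInner_conjSum_eq_zero fun y y' h => absurd
    (show ψ' = conjLin φ (y * y'⁻¹) ψ by
      rw [← conjLin_conjLin, h, conjLin_conjLin, mul_inv_cancel, conjLin_one])
    (hne _)

end LittleGroupChoice

theorem charInner_SCh_eq_zero [Finite N] {S : Set (N →* ℂˣ)} (hS : IsOrbitReps φ S)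
    {ζ ζ' : N ⋊[φ] H → ℂ} (hζ : ζ ∈ SCh c S) (hζ' : ζ' ∈ SCh c S) (hne : ζ ≠ ζ') :
    charInner ζ ζ' = 0 := by
  obtain ⟨ψ, hψ, f, hf, rfl⟩ := (mem_SCh_iff c).mp hζ
  obtain ⟨ψ', hψ', f', hf', rfl⟩ := (mem_SCh_iff c).mp hζ'
  refine charInner_smul_smul _ _ ?_
  by_cases h : ψ = ψ'
  · subst h
    exact LittleGroupChoice.charInner_conjSum_of_ne hf hf' fun h => hne (by rw [h])
  · refine LittleGroupChoice.charInner_conjSum_of_not_conj (fun y hy => h ?_) f f'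
    exact (hS ψ).unique ⟨hψ, 1, by simp⟩ ⟨hψ', y, hy⟩

theorem exists_supercharacterTheory_SCh [Finite N] {S : Set (N →* ℂˣ)} (hS : IsOrbitReps φ S) :
    ∃ T : SupercharacterTheory (N ⋊[φ] H), T.supercharacters = SCh c S := by
  obtain ⟨𝒦, h𝒦, heq⟩ := exists_isPartition_blockFunctions_eq c.superclassSpace
    LittleGroupChoice.one_mem_superclassSpace
    fun F hF F' hF' => LittleGroupChoice.mul_mem_superclassSpace hF hF'
  have hspan := LittleGroupChoice.superclassSpace_eq_span_SCh (c := c) hS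
  obtain ⟨T, _, hT⟩ := exists_supercharacterTheory (X := SCh c S)
    (fun ζ hζ => isCharacter_of_mem_SCh c hζ)
    (fun ζ hζ ζ' hζ' hne => charInner_SCh_eq_zero c hS hζ hζ' hne) h𝒦 (hspan.trans heq.symm)
    (hspan ▸ LittleGroupChoice.indicator_one_mem_superclassSpace)
  exact ⟨T, hT⟩

end SChSpan

/-! ### The `*`-product -/

section Star

open CompatibleLattice

variable {N H : Type*} [CommGroup N] [Group H] (φ : H →* MulAut N) (𝓛 : CompatibleLattice H)

open Classical in
/-- The choice of subgroups `H_ψ` for which `SCh(𝓛)` gives the `*`-product: `H_ψ = 1` for all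
nontrivial `ψ`. -/
def LittleGroupChoice.trivial : LittleGroupChoice φ 𝓛 where
  grp ψ := if ψ = 1 then ⊤ else ⊥
  mem ψ := by
    split_ifs
    exacts [𝓛.top_mem, 𝓛.bot_mem]
  le_inertia ψ := by
    split_ifs with h
    · subst h
      exact fun x _ => conjLin_trivial φ x
    · exact bot_le
  normal ψ := by
    split_ifs
    · rw [Subgroup.top_subgroupOf]
      infer_instance
    · rw [Subgroup.bot_subgroupOf]
      infer_instance
  conj ψ h := by
    have hiff : conjLin φ h ψ = 1 ↔ ψ = 1 := by
      refine ⟨fun e => ?_, fun e => by rw [e, conjLin_trivial]⟩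
      have := congrArg (conjLin φ h⁻¹) e
      rwa [conjLin_conjLin, mul_inv_cancel, conjLin_one, conjLin_trivial] at this
    simp only [hiff]
    split_ifs
    · ext x
      simp [Subgroup.mem_pointwise_smul_iff_inv_smul_mem]
    · simp
  one := if_pos rfl
  inf_le ψ ψ' := by
    by_cases h : ψ * ψ' = 1
    · rw [if_pos h]
      exact le_top
    · rw [if_neg h]
      by_cases h1 : ψ = 1
      · rw [if_neg (show ψ' ≠ 1 from fun h2 => h (by rw [h1, h2]; exact mul_one (1 : N →* ℂˣ)))]
        exact inf_le_right
      · rw [if_neg h1]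
        exact inf_le_left

theorem LittleGroupChoice.trivial_grp_of_ne {ψ : N →* ℂˣ} (h : ψ ≠ 1) :
    (LittleGroupChoice.trivial φ 𝓛).grp ψ = ⊥ := if_neg h

/-- A superclass that contains `1` is `{1}`, as the indicator of `1` is a superclass function. -/
theorem eq_singleton_one_of_one_mem [Finite H] {L : Set (⊤ : Subgroup H)}
    (hL : L ∈ (𝓛.theory ⊤ 𝓛.top_mem).superclasses) (h1 : 1 ∈ L) : L = {1} := by
  refine (Set.eq_singleton_iff_unique_mem).mpr ⟨h1, fun x hx => ?_⟩
  have h2 := (mem_superclassFunctions.mp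
    (indicator_one_mem_superclassFunctions 𝓛.top_mem)).2 L hL x hx 1 h1
  by_contra hne
  have hne' : (x : H) ∉ ({1} : Set H) := fun h => hne (Subtype.ext h)
  dsimp only at h2
  rw [Set.indicator_of_notMem hne'] at h2
  simp at h2

variable {φ 𝓛}

theorem mem_starNHSuperclasses {M : Set (N ⋊[φ] H)} :
    M ∈ starNHSuperclasses φ 𝓛 ↔
      (∃ n : N, M = SemidirectProduct.inl '' Set.range fun h : H => φ h n) ∨
      ∃ L ∈ (𝓛.theory ⊤ 𝓛.top_mem).superclasses, L ≠ {1} ∧ M = projTop φ ⁻¹' L := by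
  constructor
  · rintro (⟨_, ⟨n, rfl⟩, rfl⟩ | h)
    exacts [Or.inl ⟨n, rfl⟩, Or.inr h]
  · rintro (⟨n, rfl⟩ | h)
    exacts [Or.inl ⟨_, ⟨n, rfl⟩, rfl⟩, Or.inr h]

theorem mem_inl_image_orbit {n : N} {g : N ⋊[φ] H} :
    g ∈ (SemidirectProduct.inl '' Set.range fun h : H => φ h n : Set (N ⋊[φ] H)) ↔
      g.right = 1 ∧ ∃ h : H, φ h n = g.left := by
  constructor
  · rintro ⟨_, ⟨h, rfl⟩, rfl⟩
    exact ⟨rfl, h, rfl⟩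
  · rintro ⟨h1, h, h2⟩
    exact ⟨_, ⟨h, rfl⟩, SemidirectProduct.ext (by simpa using h2) (by simpa using h1.symm)⟩

theorem projTop_eq_one_iff {g : N ⋊[φ] H} : projTop φ g = 1 ↔ g.right = 1 := by
  simp [projTop]

theorem right_ne_one_of_projTop_mem [Finite H] {L : Set (⊤ : Subgroup H)}
    (hL : L ∈ (𝓛.theory ⊤ 𝓛.top_mem).superclasses) (hne : L ≠ {1}) {g : N ⋊[φ] H}
    (hg : projTop φ g ∈ L) : g.right ≠ 1 := fun h =>
  hne (eq_singleton_one_of_one_mem 𝓛 hL (projTop_eq_one_iff.mpr h ▸ hg))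

theorem isPartition_starNHSuperclasses [Finite H] :
    Setoid.IsPartition (starNHSuperclasses φ 𝓛) := by
  have hP := (𝓛.theory ⊤ 𝓛.top_mem).isPartition
  constructor
  · intro h
    rcases mem_starNHSuperclasses.mp h with ⟨n, hn⟩ | ⟨L, hL, _, h0⟩
    · have : SemidirectProduct.inl n ∈
          (SemidirectProduct.inl '' Set.range fun h : H => φ h n : Set (N ⋊[φ] H)) :=
        mem_inl_image_orbit.mpr ⟨rfl, 1, by simp⟩
      rw [← hn] at this
      exact this
    · obtain ⟨x, hx⟩ := Setoid.nonempty_of_mem_partition hP hL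
      have : (SemidirectProduct.inr (x : H) : N ⋊[φ] H) ∈ projTop φ ⁻¹' L := hx
      rw [← h0] at this
      exact this
  · intro g
    by_cases hg : g.right = 1
    · refine ⟨_, ⟨mem_starNHSuperclasses.mpr (Or.inl ⟨g.left, rfl⟩),
        mem_inl_image_orbit.mpr ⟨hg, 1, by simp⟩⟩, ?_⟩
      rintro M ⟨hM, hgM⟩
      rcases mem_starNHSuperclasses.mp hM with ⟨n, rfl⟩ | ⟨L, hL, hne, rfl⟩
      · obtain ⟨_, y, hy⟩ := mem_inl_image_orbit.mp hgM
        ext g'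
        rw [mem_inl_image_orbit, mem_inl_image_orbit, ← hy]
        refine and_congr_right fun _ => ⟨?_, ?_⟩
        · rintro ⟨h, hh⟩
          exact ⟨h * y⁻¹, by simpa using hh⟩
        · rintro ⟨h, hh⟩
          exact ⟨h * y, by simpa using hh⟩
      · exact absurd hg (right_ne_one_of_projTop_mem hL hne hgM)
    · obtain ⟨L, ⟨hL, hgL⟩, _⟩ := hP.2 (projTop φ g)
      have hne : L ≠ {1} := by
        rintro rfl
        exact hg (projTop_eq_one_iff.mp hgL)
      refine ⟨_, ⟨mem_starNHSuperclasses.mpr (Or.inr ⟨L, hL, hne, rfl⟩), hgL⟩, ?_⟩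
      rintro M ⟨hM, hgM⟩
      rcases mem_starNHSuperclasses.mp hM with ⟨n, rfl⟩ | ⟨L', hL', _, rfl⟩
      · exact absurd (mem_inl_image_orbit.mp hgM).1 hg
      · rw [hP.eq_of_mem hL' hL hgM hgL]

variable [Fintype H]

theorem indFun_inl [Finite N] (χ : N → ℂ) (g : N ⋊[φ] H) :
    indFun SemidirectProduct.inl χ g =
      ∑ y : H, χ (φ y g.left) * ({1} : Set H).indicator 1 (y * g.right * y⁻¹) := by
  have := Fintype.ofFinite N
  have := Fintype.ofFinite (N ⋊[φ] H)
  rw [indFun_eq_sum_extend SemidirectProduct.inl_injective]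
  have hterm : ∀ x : N ⋊[φ] H, Function.extend SemidirectProduct.inl χ 0 (x * g * x⁻¹) =
      χ (φ x.right g.left) *
        ({1} : Set H).indicator 1 (x.right * g.right * x.right⁻¹) := by
    intro x
    by_cases hg : g.right = 1
    · have h1 : x * g * x⁻¹ = SemidirectProduct.inl (φ x.right g.left) := by
        refine SemidirectProduct.ext ?_ ?_
        · simp [hg, mul_comm x.left]
        · simp [hg]
      rw [h1, SemidirectProduct.inl_injective.extend_apply]
      simp [hg]
    · rw [Function.extend_apply', Set.indicator_of_notMem, mul_zero]
      · rfl
      · simpa using hg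
      · rintro ⟨n, hn⟩
        have h1 := congrArg SemidirectProduct.right hn
        simp only [SemidirectProduct.right_inl, SemidirectProduct.mul_right,
          SemidirectProduct.inv_right] at h1
        exact hg (conj_eq_one_iff.mp h1.symm)
  have hN : (Nat.card N : ℂ) ≠ 0 := Nat.cast_ne_zero.mpr Nat.card_pos.ne'
  have hsum : ∑ x : N ⋊[φ] H, χ (φ x.right g.left) *
      ({1} : Set H).indicator 1 (x.right * g.right * x.right⁻¹) =
      Nat.card N * ∑ y : H, χ (φ y g.left) * ({1} : Set H).indicator 1 (y * g.right * y⁻¹) := by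
    refine (Fintype.sum_equiv SemidirectProduct.equivProd _
      (fun p : N × H => χ (φ p.2 g.left) *
        ({1} : Set H).indicator 1 (p.2 * g.right * p.2⁻¹)) fun _ => rfl).trans ?_
    rw [Fintype.sum_prod_type]
    dsimp only
    rw [Finset.sum_const, Finset.card_univ, nsmul_eq_mul, ← Nat.card_eq_fintype_card]
  simp only [hterm]
  rw [hsum, inv_mul_cancel_left₀ hN]

theorem indFun_inl_linearCharacter [Finite N] (ψ : N →* ℂˣ) :
    (indFun SemidirectProduct.inl (fun n => (ψ n : ℂ)) : N ⋊[φ] H → ℂ) =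
      conjSum φ ψ (({1} : Set H).indicator 1) :=
  funext fun g => indFun_inl _ g

theorem isCharacter_conjSum_indicator [Finite N] (ψ : N →* ℂˣ) :
    IsCharacter (conjSum φ ψ (({1} : Set H).indicator 1)) := by
  rw [← indFun_inl_linearCharacter]
  refine IsCharacter.indFun SemidirectProduct.inl_injective ?_
  have htriv : IsCharacter fun _ : N => (1 : ℂ) := by
    have h := Representation.isCharacter_character (1 : Representation ℂ N ℂ)
    convert h using 1
    funext n
    simp [Representation.character]
  simpa using htriv.linear_mul ψ

theorem conjSum_conjLin_indicator (ψ : N →* ℂˣ) (y : H) :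
    conjSum φ (conjLin φ y ψ) (({1} : Set H).indicator 1) =
      conjSum φ ψ (({1} : Set H).indicator 1) := by
  have h1 : (fun h => ({1} : Set H).indicator (1 : H → ℂ) (y * h * y⁻¹)) =
      ({1} : Set H).indicator 1 := by
    funext h
    by_cases hh : h = 1
    · simp [hh]
    · rw [Set.indicator_of_notMem (by simpa using hh), Set.indicator_of_notMem (by simpa using hh)]
  rw [← conjSum_conj ψ _ y, h1]

/-- Inducing the sum over the orbit of `ψ` multiplies the character induced from `ψ` by the length
of the orbit. -/
theorem indFun_inl_orbitSum [Finite N] (ψ : N →* ℂˣ) :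
    (indFun SemidirectProduct.inl
      (fun n => ∑ᶠ θ ∈ (Set.range fun h : H => conjLin φ h ψ), (θ n : ℂ)) : N ⋊[φ] H → ℂ) =
      ((Set.range fun h : H => conjLin φ h ψ).ncard : ℂ) •
        conjSum φ ψ (({1} : Set H).indicator 1) := by
  have hfin := Set.toFinite (Set.range fun h : H => conjLin φ h ψ)
  funext g
  rw [indFun_inl]
  simp only [finsum_mem_eq_finite_toFinset_sum _ hfin, Finset.sum_mul]
  rw [Finset.sum_comm, Set.ncard_eq_toFinset_card _ hfin, Pi.smul_apply, smul_eq_mul,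
    ← nsmul_eq_mul, ← Finset.sum_const]
  refine Finset.sum_congr rfl fun θ hθ => ?_
  obtain ⟨y, rfl⟩ := hfin.mem_toFinset.mp hθ
  exact congrFun (conjSum_conjLin_indicator ψ y) g

theorem orbitSum_ne_one_iff [Finite N] (ψ : N →* ℂˣ) :
    (fun n => ∑ᶠ θ ∈ (Set.range fun h : H => conjLin φ h ψ), (θ n : ℂ)) ≠ (fun _ => 1) ↔
      ψ ≠ 1 := by
  have := Fintype.ofFinite N
  refine not_congr ⟨fun h => ?_, ?_⟩
  · by_contra hψ
    have hfin := Set.toFinite (Set.range fun h : H => conjLin φ h ψ)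
    have h1 : ∑ n : N, ∑ᶠ θ ∈ (Set.range fun h : H => conjLin φ h ψ), (θ n : ℂ) =
        ∑ n : N, 1 := Finset.sum_congr rfl fun n _ => congrFun h n
    simp only [finsum_mem_eq_finite_toFinset_sum _ hfin] at h1
    rw [Finset.sum_comm, Finset.sum_eq_zero] at h1
    · simp only [Finset.sum_const, Finset.card_univ, nsmul_eq_mul, mul_one] at h1
      exact Fintype.card_ne_zero (Nat.cast_eq_zero.mp h1.symm)
    · intro θ hθ
      obtain ⟨y, rfl⟩ := hfin.mem_toFinset.mp hθ
      refine sum_linearCharacter_eq_zero fun h2 => hψ ?_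
      rw [← conjLin_one φ ψ, ← mul_inv_cancel y, ← conjLin_conjLin]
      exact (congrArg _ h2).trans (conjLin_trivial φ _)
  · rintro rfl
    funext n
    simp

theorem inflation_eq_conjSum {χ : (⊤ : Subgroup H) → ℂ}
    (hχ : IsCharacter χ) :
    (fun g => χ (projTop φ g)) =
      (Nat.card H : ℂ)⁻¹ • conjSum φ 1 (Function.extend Subtype.val χ 0) := by
  funext g
  have hc : (Nat.card H : ℂ) ≠ 0 := Nat.cast_ne_zero.mpr Nat.card_pos.ne'
  have h1 : ∀ y : H, Function.extend Subtype.val χ 0 (y * g.right * y⁻¹) = χ (projTop φ g) := by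
    intro y
    rw [extend_val_of_mem _ (Subgroup.mem_top _)]
    exact hχ.conj ⟨y, Subgroup.mem_top _⟩ (projTop φ g)
  simp only [Pi.smul_apply, conjSum, h1, MonoidHom.one_apply, Units.val_one, one_mul,
    Finset.sum_const, Finset.card_univ, nsmul_eq_mul, smul_eq_mul, ← Nat.card_eq_fintype_card,
    inv_mul_cancel_left₀ hc]

theorem mem_starNHSupercharacters_iff [Finite N] {ζ : N ⋊[φ] H → ℂ} :
    ζ ∈ starNHSupercharacters φ 𝓛 ↔
      (∃ ψ : N →* ℂˣ, ψ ≠ 1 ∧ ζ = ((Set.range fun h : H => conjLin φ h ψ).ncard : ℂ) •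
        conjSum φ ψ (({1} : Set H).indicator 1)) ∨
      ∃ f ∈ 𝓛.extendedSupercharacters ⊤ 𝓛.top_mem, ζ = (Nat.card H : ℂ)⁻¹ • conjSum φ 1 f := by
  constructor
  · rintro (⟨_, ⟨ψ, rfl⟩, hne, rfl⟩ | ⟨χ, hχ, rfl⟩)
    · exact Or.inl ⟨ψ, (orbitSum_ne_one_iff ψ).mp hne, indFun_inl_orbitSum ψ⟩
    · exact Or.inr ⟨_, ⟨χ, hχ, rfl⟩, inflation_eq_conjSum ((𝓛.theory _ _).isCharacter χ hχ)⟩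
  · rintro (⟨ψ, hψ, rfl⟩ | ⟨_, ⟨χ, hχ, rfl⟩, rfl⟩)
    · exact Or.inl ⟨_, ⟨ψ, rfl⟩, (orbitSum_ne_one_iff ψ).mpr hψ, (indFun_inl_orbitSum ψ).symm⟩
    · exact Or.inr ⟨χ, hχ, (inflation_eq_conjSum ((𝓛.theory _ _).isCharacter χ hχ)).symm⟩

theorem ncard_orbit_pos [Finite N] (ψ : N →* ℂˣ) :
    0 < (Set.range fun h : H => conjLin φ h ψ).ncard :=
  (Set.ncard_pos (Set.toFinite _)).mpr (Set.range_nonempty _)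

theorem isCharacter_of_mem_starNHSupercharacters [Finite N] {ζ : N ⋊[φ] H → ℂ}
    (hζ : ζ ∈ starNHSupercharacters φ 𝓛) : IsCharacter ζ := by
  rcases mem_starNHSupercharacters_iff.mp hζ with ⟨ψ, _, rfl⟩ | ⟨_, ⟨χ, hχ, rfl⟩, rfl⟩
  · exact (isCharacter_conjSum_indicator ψ).nsmul (ncard_orbit_pos ψ)
  · have hχ' := (𝓛.theory _ _).isCharacter χ hχ
    rw [← inflation_eq_conjSum hχ']
    exact hχ'.comp (projTop φ)

theorem charInner_starNHSupercharacters_eq_zero [Finite N] {ζ ζ' : N ⋊[φ] H → ℂ}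
    (hζ : ζ ∈ starNHSupercharacters φ 𝓛) (hζ' : ζ' ∈ starNHSupercharacters φ 𝓛) (hne : ζ ≠ ζ') :
    charInner ζ ζ' = 0 := by
  have htriv : ∀ (ψ : N →* ℂˣ), ψ ≠ 1 → ∀ y : H, ψ ≠ conjLin φ y 1 := fun ψ hψ y h =>
    hψ (h.trans (conjLin_trivial φ y))
  rcases mem_starNHSupercharacters_iff.mp hζ with ⟨ψ, hψ, rfl⟩ | ⟨f, hf, rfl⟩ <;>
    rcases mem_starNHSupercharacters_iff.mp hζ' with ⟨ψ', hψ', rfl⟩ | ⟨f', hf', rfl⟩ <;>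
    refine charInner_smul_smul _ _ ?_
  · refine LittleGroupChoice.charInner_conjSum_of_not_conj (fun y hy => hne ?_) _ _
    subst hy
    rw [conjSum_conjLin_indicator]
    congr 3
    ext θ
    constructor
    · rintro ⟨h, rfl⟩
      exact ⟨y⁻¹ * h, by simp [conjLin_conjLin]⟩
    · rintro ⟨h, rfl⟩
      exact ⟨y * h, by simp [conjLin_conjLin]⟩
  · exact charInner_eq_zero_comm.mp
      (LittleGroupChoice.charInner_conjSum_of_not_conj (htriv ψ hψ) _ _)
  · exact LittleGroupChoice.charInner_conjSum_of_not_conj (htriv ψ' hψ') _ _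
  · let c := LittleGroupChoice.trivial φ 𝓛
    rw [← extendedSupercharacters_congr c.one (c.mem 1)] at hf hf'
    exact LittleGroupChoice.charInner_conjSum_of_ne hf hf' fun h => hne (by rw [h])

variable {c : LittleGroupChoice φ 𝓛}

/-- A function that is constant on the superclasses of the `*`-product is the sum of a function on
`N` constant on the orbits of `H`, extended by zero, and the inflation of a superclass function of
`H` that vanishes at `1`. -/
theorem blockFunctions_star_le_superclassSpace [Finite N] :
    blockFunctions (starNHSuperclasses φ 𝓛) ≤ c.superclassSpace := by
  classical
  intro F hF
  let F₁ : N → ℂ := fun n => F (SemidirectProduct.inl n)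
  let F₂ : H → ℂ := fun h => if h = 1 then 0 else F (SemidirectProduct.inr h)
  have h₁ : ∀ (y : H) (n : N), F₁ (φ y n) = F₁ n := fun y n =>
    hF _ (mem_starNHSuperclasses.mpr (Or.inl ⟨n, rfl⟩)) _ (mem_inl_image_orbit.mpr ⟨rfl, y, rfl⟩)
      _ (mem_inl_image_orbit.mpr ⟨rfl, 1, by simp⟩)
  have hP := (𝓛.theory ⊤ 𝓛.top_mem).isPartition
  have hF' : ∀ g : N ⋊[φ] H, g.right ≠ 1 → ∀ g' : N ⋊[φ] H,
      (∃ L ∈ (𝓛.theory ⊤ 𝓛.top_mem).superclasses, projTop φ g ∈ L ∧ projTop φ g' ∈ L) →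
      F g = F g' := by
    rintro g hg g' ⟨L, hL, hgL, hgL'⟩
    refine hF _ (mem_starNHSuperclasses.mpr (Or.inr ⟨L, hL, ?_, rfl⟩)) _ hgL _ hgL'
    rintro rfl
    exact hg (projTop_eq_one_iff.mp hgL)
  have h₂ : (𝓛.theory ⊤ 𝓛.top_mem).IsSuperclassFunction fun x => F₂ x := by
    intro L hL x hx y hy
    by_cases hx1 : (x : H) = 1
    · have : L = {1} := eq_singleton_one_of_one_mem 𝓛 hL
        ((show x = 1 from Subtype.ext hx1) ▸ hx)
      rw [this] at hx hy
      rw [Set.mem_singleton_iff.mp hx, Set.mem_singleton_iff.mp hy]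
    · have hy1 : (y : H) ≠ 1 := fun h => hx1 <| by
        have : L = {1} := eq_singleton_one_of_one_mem 𝓛 hL
          ((show y = 1 from Subtype.ext h) ▸ hy)
        rw [this] at hx
        rw [Set.mem_singleton_iff.mp hx, Subgroup.coe_one]
      simp only [F₂, if_neg hx1, if_neg hy1]
      exact hF' _ hx1 _ ⟨L, hL, hx, hy⟩
  have h₂' : F₂ ∈ 𝓛.superclassFunctions ⊤ 𝓛.top_mem :=
    mem_superclassFunctions.mpr ⟨fun h hh => absurd (Subgroup.mem_top h) hh, h₂⟩
  have h₂c : ∀ y h, F₂ (y * h * y⁻¹) = F₂ h := by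
    intro y h
    obtain ⟨L, ⟨hL, hhL⟩, _⟩ := hP.2 (⟨h, Subgroup.mem_top h⟩ : (⊤ : Subgroup H))
    have := (𝓛.theory ⊤ 𝓛.top_mem).conj_mem L hL _ hhL ⟨y, Subgroup.mem_top y⟩
    exact h₂ L hL _ this _ hhL
  have hsum := c.superclassSpace.add_mem
    (LittleGroupChoice.extendOrbitFunction_mem_superclassSpace h₁)
    (LittleGroupChoice.inflation_mem_superclassSpace h₂' h₂c)
  convert hsum using 1
  funext g
  rw [Pi.add_apply]
  by_cases hg : g.right = 1
  · have : g = SemidirectProduct.inl g.left := SemidirectProduct.ext rfl hg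
    simp only [F₁, F₂, hg, if_true, ← this]
    simp
  · simp only [F₂, if_neg hg]
    rw [Set.indicator_of_notMem (by simpa using hg), mul_zero, zero_add]
    obtain ⟨L, ⟨hL, hgL⟩, _⟩ := hP.2 (projTop φ g)
    exact hF' g hg _ ⟨L, hL, hgL, hgL⟩

theorem span_starNHSupercharacters_le [Finite N] :
    Submodule.span ℂ (starNHSupercharacters φ 𝓛) ≤ blockFunctions (starNHSuperclasses φ 𝓛) := by
  refine Submodule.span_le.mpr fun ζ hζ M hM => ?_
  have hconj := fun y => (isCharacter_of_mem_starNHSupercharacters hζ).conj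
    (SemidirectProduct.inr y : N ⋊[φ] H)
  rcases mem_starNHSuperclasses.mp hM with ⟨n, rfl⟩ | ⟨L, hL, hne, rfl⟩
  · have key : ∀ x ∈ (SemidirectProduct.inl '' Set.range fun h : H => φ h n : Set (N ⋊[φ] H)),
        ζ x = ζ (SemidirectProduct.inl n) := by
      rintro _ ⟨_, ⟨y, rfl⟩, rfl⟩
      rw [← hconj y (SemidirectProduct.inl n)]
      congr 1
      simp [SemidirectProduct.inl_aut]
    intro x hx y hy
    rw [key x hx, key y hy]
  · intro x hx y hy
    rcases hζ with ⟨χ, _, _, rfl⟩ | ⟨χ, hχ, rfl⟩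
    · have h0 : ∀ g : N ⋊[φ] H, g.right ≠ 1 → indFun SemidirectProduct.inl χ g = 0 := by
        intro g hg
        rw [indFun_inl]
        refine Finset.sum_eq_zero fun y _ => ?_
        rw [Set.indicator_of_notMem (by simpa using hg), mul_zero]
      rw [h0 x (right_ne_one_of_projTop_mem hL hne hx),
        h0 y (right_ne_one_of_projTop_mem hL hne hy)]
    · exact (𝓛.theory ⊤ 𝓛.top_mem).constant χ hχ L hL _ hx _ hy

theorem superclassSpace_le_span_starNHSupercharacters [Finite N]
    (hc : ∀ ψ : N →* ℂˣ, ψ ≠ 1 → c.grp ψ = ⊥) :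
    c.superclassSpace ≤ Submodule.span ℂ (starNHSupercharacters φ 𝓛) := by
  refine Submodule.span_le.mpr ?_
  rintro _ ⟨ψ, f, hf, rfl⟩
  by_cases hψ : ψ = 1
  · subst hψ
    rw [superclassFunctions_congr c.one _ 𝓛.top_mem, ← span_extendedSupercharacters] at hf
    induction hf using Submodule.span_induction with
    | mem f h =>
      have hc : (Nat.card H : ℂ) ≠ 0 := Nat.cast_ne_zero.mpr Nat.card_pos.ne'
      exact (Submodule.smul_mem_iff _ (inv_ne_zero hc)).mp
        (Submodule.subset_span (mem_starNHSupercharacters_iff.mpr (Or.inr ⟨f, h, rfl⟩)))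
    | zero =>
      have : conjSum φ 1 (0 : H → ℂ) = 0 := by
        simpa using conjSum_smul (φ := φ) 1 0 (0 : H → ℂ)
      rw [this]
      exact Submodule.zero_mem _
    | add f₁ f₂ _ _ h₁ h₂ => rw [conjSum_add]; exact Submodule.add_mem _ h₁ h₂
    | smul a f₁ _ h₁ => rw [conjSum_smul]; exact Submodule.smul_mem _ a h₁
  · rw [superclassFunctions_congr (hc ψ hψ) _ 𝓛.bot_mem] at hf
    rw [eq_smul_indicator_of_mem_superclassFunctions_bot hf, conjSum_smul]
    refine Submodule.smul_mem _ _ ?_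
    exact (Submodule.smul_mem_iff _ (Nat.cast_ne_zero.mpr (ncard_orbit_pos (φ := φ) ψ).ne')).mp
      (Submodule.subset_span (mem_starNHSupercharacters_iff.mpr (Or.inl ⟨ψ, hψ, rfl⟩)))

/-- The spans form a cycle of inclusions through the space that `LittleGroupChoice.trivial` defines,
so no count of the orbits on `N` and on `Irr(N)` is needed. -/
theorem span_starNHSupercharacters_eq [Finite N] :
    Submodule.span ℂ (starNHSupercharacters φ 𝓛) = blockFunctions (starNHSuperclasses φ 𝓛) :=
  span_starNHSupercharacters_le.antisymm
    ((blockFunctions_star_le_superclassSpace (c := LittleGroupChoice.trivial φ 𝓛)).trans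
      (superclassSpace_le_span_starNHSupercharacters fun _ hψ =>
        LittleGroupChoice.trivial_grp_of_ne φ 𝓛 hψ))

theorem exists_supercharacterTheory_starNH [Finite N] :
    ∃ T : SupercharacterTheory (N ⋊[φ] H), T.superclasses = starNHSuperclasses φ 𝓛 ∧
      T.supercharacters = starNHSupercharacters φ 𝓛 :=
  exists_supercharacterTheory (fun _ => isCharacter_of_mem_starNHSupercharacters)
    (fun _ h _ h' => charInner_starNHSupercharacters_eq_zero h h')
    isPartition_starNHSuperclasses span_starNHSupercharacters_eq
    (superclassSpace_le_span_starNHSupercharacters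
      (fun _ hψ => LittleGroupChoice.trivial_grp_of_ne φ 𝓛 hψ)
      LittleGroupChoice.indicator_one_mem_superclassSpace)

/-! ### Comparison of the two theories -/

/-- For `h ≠ 1` in `H_ψ`, the function `n ↦ conjSum ψ 1_{H_ψ} (n h)` is a nonempty sum of
nontrivial characters of `N`, hence not constant. -/
theorem grp_eq_bot_of_superclassSpace_le [Finite N]
    (hle : c.superclassSpace ≤ blockFunctions (starNHSuperclasses φ 𝓛)) {ψ : N →* ℂˣ}
    (hψ : ψ ≠ 1) : c.grp ψ = ⊥ := by
  classical
  have := Fintype.ofFinite N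
  by_contra hcon
  obtain ⟨x, hx⟩ := Subgroup.ne_bot_iff_exists_ne_one.mp hcon
  have hx' : (x : H) ≠ 1 := fun h => hx (Subtype.ext h)
  let f : H → ℂ := (c.grp ψ : Set H).indicator 1
  have hf : f ∈ 𝓛.superclassFunctions (c.grp ψ) (c.mem ψ) := by
    refine mem_superclassFunctions.mpr
      ⟨fun h hh => Set.indicator_of_notMem hh _, fun L _ y _ z _ => ?_⟩
    simp only [f, Set.indicator_of_mem (SetLike.mem_coe.mpr y.2),
      Set.indicator_of_mem (SetLike.mem_coe.mpr z.2), Pi.one_apply]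
  have hF := hle (LittleGroupChoice.conjSum_mem_superclassSpace hf)
  obtain ⟨L, ⟨hL, hxL⟩, _⟩ :=
    (𝓛.theory ⊤ 𝓛.top_mem).isPartition.2 (⟨x, Subgroup.mem_top _⟩ : (⊤ : Subgroup H))
  have hL1 : L ≠ {1} := by
    rintro rfl
    exact hx' (congrArg Subtype.val (Set.mem_singleton_iff.mp hxL))
  have hconst : ∀ n : N, conjSum φ ψ f ⟨n, x⟩ = conjSum φ ψ f ⟨1, x⟩ := fun n =>
    hF _ (mem_starNHSuperclasses.mpr (Or.inr ⟨L, hL, hL1, rfl⟩)) _ hxL _ hxL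
  -- The constant is positive, as `y = 1` is counted, but its sum over `N` vanishes.
  have hone : conjSum φ ψ f ⟨1, x⟩ =
      ((Finset.univ.filter fun y : H => y * x * y⁻¹ ∈ c.grp ψ).card : ℂ) := by
    simp [conjSum, f, Set.indicator_apply, Finset.sum_boole]
  have hsum : ∑ n : N, conjSum φ ψ f ⟨n, x⟩ = 0 := by
    simp only [conjSum]
    rw [Finset.sum_comm]
    refine Finset.sum_eq_zero fun y _ => ?_
    have hy : conjLin φ y ψ ≠ 1 := fun h2 => hψ <| by
      rw [← conjLin_one φ ψ, ← mul_inv_cancel y, ← conjLin_conjLin, h2, conjLin_trivial]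
    rw [← Finset.sum_mul, mul_eq_zero]
    exact Or.inl (sum_linearCharacter_eq_zero hy)
  simp only [hconst, Finset.sum_const, Finset.card_univ, nsmul_eq_mul, hone] at hsum
  have hpos : (Finset.univ.filter fun y : H => y * x * y⁻¹ ∈ c.grp ψ).card ≠ 0 :=
    Finset.card_ne_zero_of_mem (a := 1) (by simp)
  exact mul_ne_zero (Nat.cast_ne_zero.mpr Fintype.card_ne_zero) (Nat.cast_ne_zero.mpr hpos) hsum

theorem exists_mem_extendedSupercharacters_bot :
    (𝓛.extendedSupercharacters ⊥ 𝓛.bot_mem).Nonempty := by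
  rw [Set.nonempty_iff_ne_empty]
  intro h0
  have h1 := indicator_one_mem_superclassFunctions 𝓛.bot_mem
  rw [← span_extendedSupercharacters, h0, Submodule.span_empty, Submodule.mem_bot] at h1
  simpa using congrFun h1 1

theorem eq_smul_indicator_of_mem_extendedSupercharacters_bot {f : H → ℂ}
    (hf : f ∈ 𝓛.extendedSupercharacters ⊥ 𝓛.bot_mem) :
    ∃ m : ℕ, 0 < m ∧ f = (m : ℂ) • ({1} : Set H).indicator 1 := by
  have h1 := eq_smul_indicator_of_mem_superclassFunctions_bot
    (span_extendedSupercharacters 𝓛.bot_mem ▸ Submodule.subset_span hf)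
  obtain ⟨χ, hχ, rfl⟩ := hf
  obtain ⟨m, hm, h2⟩ := ((𝓛.theory _ _).isCharacter χ hχ).apply_one_pos
  refine ⟨m, hm, ?_⟩
  rw [h1, ← h2]
  exact congrArg (· • _) (extend_val_of_mem χ (one_mem _))

/-- If `H_ψ = 1`, both theories contain a positive multiple of the character induced from `ψ`: in
`SCh(𝓛)` the factor is the value of a supercharacter of the trivial group, in the `*`-product it is
the length of the orbit of `ψ`. -/
theorem sameUpToScaling_of_grp_eq_bot [Finite N] {S : Set (N →* ℂˣ)} (hS : IsOrbitReps φ S)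
    (hc : ∀ ψ : N →* ℂˣ, ψ ≠ 1 → c.grp ψ = ⊥) :
    SameUpToScaling (SCh c S) (starNHSupercharacters φ 𝓛) := by
  have hcard1 : (Nat.card (c.grp 1) : ℂ) = Nat.card H := by
    rw [c.one, Nat.card_congr (Subgroup.topEquiv (G := H)).toEquiv]
  have hcard : ∀ ψ : N →* ℂˣ, ψ ≠ 1 → (Nat.card (c.grp ψ) : ℂ) = 1 := fun ψ hψ => by
    rw [hc ψ hψ, Subgroup.card_bot, Nat.cast_one]
  constructor
  · intro ζ hζ
    obtain ⟨ψ, hψS, f, hf, rfl⟩ := (mem_SCh_iff c).mp hζ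
    by_cases hψ : ψ = 1
    · subst hψ
      rw [extendedSupercharacters_congr c.one _ 𝓛.top_mem] at hf
      refine ⟨1, one_pos, ?_⟩
      rw [Complex.ofReal_one, one_smul, hcard1]
      exact mem_starNHSupercharacters_iff.mpr (Or.inr ⟨f, hf, rfl⟩)
    · rw [extendedSupercharacters_congr (hc ψ hψ) _ 𝓛.bot_mem] at hf
      obtain ⟨m, hm, rfl⟩ := eq_smul_indicator_of_mem_extendedSupercharacters_bot hf
      refine ⟨(Set.range fun h : H => conjLin φ h ψ).ncard / m,
        div_pos (Nat.cast_pos.mpr (ncard_orbit_pos ψ)) (Nat.cast_pos.mpr hm),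
        mem_starNHSupercharacters_iff.mpr (Or.inl ⟨ψ, hψ, ?_⟩)⟩
      have hm' : (m : ℂ) ≠ 0 := Nat.cast_ne_zero.mpr hm.ne'
      rw [hcard ψ hψ, inv_one, one_smul, conjSum_smul, smul_smul]
      push_cast
      rw [div_mul_cancel₀ _ hm']
  · intro ζ hζ
    rcases mem_starNHSupercharacters_iff.mp hζ with ⟨ψ, hψ, rfl⟩ | ⟨f, hf, rfl⟩
    · obtain ⟨s, ⟨hs, y, rfl⟩, _⟩ := hS ψ
      obtain ⟨f, hf⟩ := exists_mem_extendedSupercharacters_bot (𝓛 := 𝓛)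
      obtain ⟨m, hm, rfl⟩ := eq_smul_indicator_of_mem_extendedSupercharacters_bot hf
      have hy : conjLin φ y ψ ≠ 1 := fun h2 => hψ <| by
        rw [← conjLin_one φ ψ, ← mul_inv_cancel y, ← conjLin_conjLin, h2, conjLin_trivial]
      refine ⟨m / (Set.range fun h : H => conjLin φ h ψ).ncard,
        div_pos (Nat.cast_pos.mpr hm) (Nat.cast_pos.mpr (ncard_orbit_pos ψ)),
        (mem_SCh_iff c).mpr ⟨_, hs, (m : ℂ) • ({1} : Set H).indicator 1, ?_, ?_⟩⟩
      · rwa [extendedSupercharacters_congr (hc _ hy) _ 𝓛.bot_mem]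
      · have hn : ((Set.range fun h : H => conjLin φ h ψ).ncard : ℂ) ≠ 0 :=
          Nat.cast_ne_zero.mpr (ncard_orbit_pos ψ).ne'
        rw [hcard _ hy, inv_one, one_smul, conjSum_smul, conjSum_conjLin_indicator, smul_smul]
        push_cast
        rw [div_mul_cancel₀ _ hn]
    · obtain ⟨s, ⟨hs, y, rfl⟩, _⟩ := hS 1
      rw [conjLin_trivial] at hs
      refine ⟨1, one_pos, (mem_SCh_iff c).mpr ⟨1, hs, f, ?_, ?_⟩⟩
      · rwa [extendedSupercharacters_congr c.one _ 𝓛.top_mem]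
      · rw [Complex.ofReal_one, one_smul, hcard1]

theorem span_eq_of_sameUpToScaling {G : Type*} {X Y : Set (G → ℂ)} (h : SameUpToScaling X Y) :
    Submodule.span ℂ X = Submodule.span ℂ Y := by
  have key : ∀ {X Y : Set (G → ℂ)}, (∀ χ ∈ X, ∃ a : ℝ, 0 < a ∧ (a : ℂ) • χ ∈ Y) →
      Submodule.span ℂ X ≤ Submodule.span ℂ Y := fun hXY =>
    Submodule.span_le.mpr fun χ hχ => by
      obtain ⟨a, ha, hY⟩ := hXY χ hχ
      exact (Submodule.smul_mem_iff _ (Complex.ofReal_ne_zero.mpr ha.ne')).mp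
        (Submodule.subset_span hY)
  exact (key h.1).antisymm (key h.2)

end Star

end

theorem mainTheorem5 {N H : Type*} [CommGroup N] [Finite N] [Group H] [Finite H]
    (φ : H →* MulAut N) (𝓛 : CompatibleLattice H) (c : LittleGroupChoice φ 𝓛)
    (S : Set (N →* ℂˣ)) (hS : IsOrbitReps φ S) :
    (∃! T : SupercharacterTheory (N ⋊[φ] H), T.supercharacters = SCh c S) ∧
    (∃! T : SupercharacterTheory (N ⋊[φ] H),
      T.superclasses = starNHSuperclasses φ 𝓛 ∧
      T.supercharacters = starNHSupercharacters φ 𝓛) ∧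
    ∀ T T' : SupercharacterTheory (N ⋊[φ] H),
      T.supercharacters = SCh c S →
      T'.superclasses = starNHSuperclasses φ 𝓛 →
      T'.supercharacters = starNHSupercharacters φ 𝓛 →
      T.IsFinerThan T' ∧
      (T.superclasses = T'.superclasses ↔ ∀ ψ : N →* ℂˣ, ψ ≠ 1 → c.grp ψ = ⊥) ∧
      (SameUpToScaling T.supercharacters T'.supercharacters ↔
        ∀ ψ : N →* ℂˣ, ψ ≠ 1 → c.grp ψ = ⊥) := by
  have := Fintype.ofFinite H
  refine ⟨?_, ?_, ?_⟩
  · obtain ⟨T, hT⟩ := exists_supercharacterTheory_SCh c hS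
    exact ⟨T, hT, fun T' hT' =>
      SupercharacterTheory.eq_of_supercharacters_eq (hT'.trans hT.symm)⟩
  · obtain ⟨T, hT⟩ := exists_supercharacterTheory_starNH (φ := φ) (𝓛 := 𝓛)
    exact ⟨T, hT, fun T' hT' =>
      SupercharacterTheory.eq_of_supercharacters_eq (hT'.2.trans hT.2.symm)⟩
  · intro T T' hT _ hT'
    have hspan : Submodule.span ℂ T.supercharacters = c.superclassSpace := by
      rw [hT, LittleGroupChoice.superclassSpace_eq_span_SCh hS]
    have hspan' : Submodule.span ℂ T'.supercharacters =
        blockFunctions (starNHSuperclasses φ 𝓛) := by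
      rw [hT', span_starNHSupercharacters_eq]
    have hle : Submodule.span ℂ T'.supercharacters ≤ Submodule.span ℂ T.supercharacters := by
      rw [hspan, hspan']
      exact blockFunctions_star_le_superclassSpace
    have hiff : T.superclasses = T'.superclasses ↔ ∀ ψ : N →* ℂˣ, ψ ≠ 1 → c.grp ψ = ⊥ := by
      rw [T.superclasses_eq_iff]
      refine ⟨fun h ψ hψ => grp_eq_bot_of_superclassSpace_le ?_ hψ, fun hc => hle.antisymm' ?_⟩
      · rw [← hspan, ← hspan', h]
      · rw [hspan, hT']
        exact superclassSpace_le_span_starNHSupercharacters hc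
    refine ⟨SupercharacterTheory.isFinerThan_of_span_le hle, hiff, fun h => ?_, fun hc => ?_⟩
    · exact hiff.mp ((T.superclasses_eq_iff T').mpr (span_eq_of_sameUpToScaling h))
    · rw [hT, hT']
      exact sameUpToScaling_of_grp_eq_bot hS hc
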